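/- Let $(w_1(y),w_2(y))_{y\ge 0}$ be an i.i.d. sequence of pairs of positive random variables such that the laws of $w_1=w_1(0)$ and $w_2=w_2(0)$ are compactly supported in $(0,\infty)$, $w_1$ and $w_2$ are independent, $w_2$ is not deterministic, and $\mathbb E[\log w_2]=0$. For $z\in\mathbb C$ put $$\mathbb M^z_y=\begin{pmatrix} z\,w_1(y) & w_2(y)^2\\ 1&0\end{pmatrix},\qquad L(z)=\lim_{n\to\infty}\frac1n\,\mathbb E\big[\log\|\mathbb M^z_0\mathbb M^z_1\cdots\mathbb M^z_{n-1}\|\big],$$ the top Lyapunov exponent of the i.i.d. matrices $\mathbb M^z_y$, where $\|A\|=\sum_{i,j}|A_{ij}|$ (any other matrix norm gives the same limit). This limit exists for every $z\in\mathbb C$. Let $a,b>0$ and, for $\theta\in\mathbb R$, let $z(\theta)=i a e^{-i\theta}-i b e^{i\theta}$. Then the function $\theta\mapsto L(z(\theta))$ is strictly increasing on $[0,\pi/2]$; it is differentiable at every $\theta\in(0,\pi/2)$, with $$\frac{\partial}{\partial\theta}L(z(\theta))>0,\qquad \theta\in(0,\pi/2);$$ and it is twice continuously differentiable in a neighbourhood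 of $\pi/2$, with $$\frac{\partial}{\partial\theta}\Big|_{\theta=\pi/2}L(z(\theta))=0,\qquad \frac{\partial^2}{\partial\theta^2}\Big|_{\theta=\pi/2}L(z(\theta))<0.$$ -/

import Mathlib

open MeasureTheory ProbabilityTheory Filter Topology Set

noncomputable section

namespace LayeredDimer

/-- Standing assumptions on the random weights: `(w₁ y, w₂ y)`, `y = 0, 1, 2, …`, is an i.i.d.
sequence of pairs of random variables whose common marginal laws are compactly supported in
`(0, ∞)`; the two components are independent, the second one is not deterministic, and its
logarithm is centered. -/
structure IsDisorder {Ω : Type*} [MeasurableSpace Ω] (P : Measure Ω)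
    (w₁ w₂ : ℕ → Ω → ℝ) : Prop where
  measurable_fst : ∀ y, Measurable (w₁ y)
  measurable_snd : ∀ y, Measurable (w₂ y)
  /-- independence of the pairs with different indices -/
  iIndep : iIndepFun (fun y ω => (w₁ y ω, w₂ y ω)) P
  /-- all the pairs have the same law -/
  identDistrib : ∀ y, IdentDistrib (fun ω => (w₁ y ω, w₂ y ω)) (fun ω => (w₁ 0 ω, w₂ 0 ω)) P P
  /-- the two weights of a pair are independent -/
  indep : IndepFun (w₁ 0) (w₂ 0) P
  compact_fst : ∃ K : Set ℝ, IsCompact K ∧ K ⊆ Ioi 0 ∧ ∀ᵐ ω ∂P, w₁ 0 ω ∈ K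
  compact_snd : ∃ K : Set ℝ, IsCompact K ∧ K ⊆ Ioi 0 ∧ ∀ᵐ ω ∂P, w₂ 0 ω ∈ K
  not_deterministic : ¬ ∃ c : ℝ, ∀ᵐ ω ∂P, w₂ 0 ω = c
  centered : ∫ ω, Real.log (w₂ 0 ω) ∂P = 0

/-- The transfer matrix `𝕄^z` with weights `w₁, w₂`. -/
def transferMatrix (z : ℂ) (w₁ w₂ : ℝ) : Matrix (Fin 2) (Fin 2) ℂ :=
  !![z * (w₁ : ℂ), (w₂ : ℂ) ^ 2; 1, 0]

/-- The entrywise `ℓ¹` norm of a matrix (it is submultiplicative; the Lyapunov exponent does not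
depend on the choice of the matrix norm). -/
def matNorm (A : Matrix (Fin 2) (Fin 2) ℂ) : ℝ := ∑ i, ∑ j, ‖A i j‖

/-- The mean growth `(1/n) 𝔼[log ‖A₀ A₁ ⋯ Aₙ₋₁‖]` of a product of `n` random matrices. -/
def meanLogGrowth {Ω : Type*} [MeasurableSpace Ω] (P : Measure Ω)
    (A : ℕ → Ω → Matrix (Fin 2) (Fin 2) ℂ) (n : ℕ) : ℝ :=
  (1 / (n : ℝ)) * ∫ ω, Real.log (matNorm ((List.range n).map (fun y => A y ω)).prod) ∂P

/-- The top Lyapunov exponent `lim (1/n) 𝔼[log ‖A₀ A₁ ⋯ Aₙ₋₁‖]` of a sequence of random matrices. -/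
def topLyapunov {Ω : Type*} [MeasurableSpace Ω] (P : Measure Ω)
    (A : ℕ → Ω → Matrix (Fin 2) (Fin 2) ℂ) : ℝ :=
  limUnder atTop (meanLogGrowth P A)

/-- The function `L(z)`: the top Lyapunov exponent of the i.i.d. transfer matrices at `z`. -/
def lyap {Ω : Type*} [MeasurableSpace Ω] (P : Measure Ω) (w₁ w₂ : ℕ → Ω → ℝ) (z : ℂ) : ℝ :=
  topLyapunov P (fun y ω => transferMatrix z (w₁ y ω) (w₂ y ω))

/-- The quarter of ellipse `z(θ) = i a e^{-iθ} - i b e^{iθ}` (the formula makes sense for all real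
`θ`). -/
def ellipse (a b θ : ℝ) : ℂ :=
  Complex.I * a * Complex.exp (-(Complex.I * θ)) - Complex.I * b * Complex.exp (Complex.I * θ)

end LayeredDimer

end

/-!
# Monotonicity of the Lyapunov exponent along a quarter of an ellipse

The existence of `L(z)` is Fekete's lemma: `𝔼 log ‖𝕄₀ ⋯ 𝕄ₙ₋₁‖` is subadditive because the weights
are i.i.d. (`IsDisorder.tendsto_meanLogGrowth`).

Up to a bounded factor, the norm of the product is, for `Re z > 0`, the modulus of its upper left
entry `Kₙ(z)`, a polynomial of degree `n` (a `continuant`). The continued fraction `Kₙ₊₁ / Kₙ`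
preserves the right half plane, and `Kₙ(-z) = ± Kₙ(z)`, so that all the zeros of `Kₙ` are purely
imaginary; they are also bounded independently of `n`. Writing them as `i λ` and pairing `z` with
`-z`, `|Kₙ(z)|⁴ = lead⁴ ∏ |z² + λ²|²` (`norm_continuant_sq`).

With `z = z(θ)`, each factor `|z(θ)² + t|²`, `t ≥ 0`, equals `(Y - t)² + 4 (a + b)² t sin² θ`,
where `Y = |z(θ)|² = (a - b)² + 4 a b sin² θ`; it is an increasing function of `sin² θ`. Hence its
logarithm has positive derivative on `(0, π/2)` and a nondegenerate maximum at `π/2`, with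
estimates that are uniform for `t` in a compact interval (`exists_isProfile_log_factor`).

Therefore the functions `θ ↦ (1/n) log |Kₙ(z(θ))|` satisfy, uniformly in `n` and in the weights,
the lower bound on the derivative, the upper bound on the second derivative at `π/2`, and Taylor
estimates of the second order on compact subintervals of `(0, π)`. All of these are closed
inequalities (`IsProfile`), which pass to the expectation and then to the limit `n → ∞`
(`IsProfile.integral`, `IsProfile.exists_of_tendsto`), so they hold for `θ ↦ L(z(θ))`. At the
endpoint `θ = 0`, where `z` is on the imaginary axis, it is enough that `‖𝕄₀ ⋯ 𝕄ₙ₋₁‖` is at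
most as large at `z(0)` as at `z(θ)`.
-/

namespace LayeredDimer

/-! ### Continuants and their zeros -/

open Polynomial in
/-- The continuant of the weights `v y = (w₁ y, w₂ y)`: the polynomial in `z` which is the upper
left entry of the product of the first `n` transfer matrices. -/
noncomputable def continuant (v : ℕ → ℝ × ℝ) : ℕ → ℂ[X]
  | 0 => 1
  | 1 => C ((v 0).1 : ℂ) * X
  | n + 2 => C ((v (n + 1)).1 : ℂ) * X * continuant v (n + 1)
      + C (((v n).2 : ℂ) ^ 2) * continuant v n

/-- The sequence of weights `v` without its first `k` terms. -/
def shift (k : ℕ) (v : ℕ → ℝ × ℝ) : ℕ → ℝ × ℝ := fun n => v (k + n)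

/-- All the weights lie in `[m, M]`. -/
def IsBoxed (m M : ℝ) (v : ℕ → ℝ × ℝ) : Prop :=
  ∀ n, (m ≤ (v n).1 ∧ (v n).1 ≤ M) ∧ (m ≤ (v n).2 ∧ (v n).2 ≤ M)

lemma IsBoxed.shift {m M : ℝ} {v : ℕ → ℝ × ℝ} (h : IsBoxed m M v) (k : ℕ) :
    IsBoxed m M (shift k v) := fun n => h (k + n)

lemma continuant_eval_zero (v : ℕ → ℝ × ℝ) (z : ℂ) : (continuant v 0).eval z = 1 := by
  simp [continuant]

lemma continuant_eval_one (v : ℕ → ℝ × ℝ) (z : ℂ) :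
    (continuant v 1).eval z = (v 0).1 * z := by
  simp [continuant]

lemma continuant_eval_add_two (v : ℕ → ℝ × ℝ) (z : ℂ) (n : ℕ) :
    (continuant v (n + 2)).eval z = (v (n + 1)).1 * z * (continuant v (n + 1)).eval z
      + (v n).2 ^ 2 * (continuant v n).eval z := by
  simp [continuant]

/-- The three-term recursion from the other end of the sequence of weights. -/
lemma continuant_eval_add_two_left (v : ℕ → ℝ × ℝ) (z : ℂ) (n : ℕ) :
    (continuant v (n + 2)).eval z = (v 0).1 * z * (continuant (shift 1 v) (n + 1)).eval z
      + (v 0).2 ^ 2 * (continuant (shift 2 v) n).eval z := by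
  induction n using Nat.twoStepInduction with
  | zero =>
    rw [continuant_eval_add_two]
    simp only [zero_add, continuant_eval_one, continuant_eval_zero, shift]
    norm_num
    ring
  | one =>
    rw [continuant_eval_add_two, continuant_eval_add_two, continuant_eval_add_two]
    simp only [zero_add, continuant_eval_one, continuant_eval_zero, shift]
    norm_num
    ring
  | more n h1 h2 =>
    rw [continuant_eval_add_two, h2, h1, continuant_eval_add_two (shift 1 v) z (n + 1),
      continuant_eval_add_two (shift 2 v)]
    have e1 : 1 + (n + 1 + 1) = n + 2 + 1 := by omega
    have e2 : 1 + (n + 1) = n + 2 := by omega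
    have e3 : 2 + (n + 1) = n + 2 + 1 := by omega
    have e4 : 2 + n = n + 2 := by omega
    simp only [shift, e1, e2, e3, e4]
    ring

/-- The `n`-th continuant is an even or odd polynomial, like `n`. -/
lemma continuant_eval_neg (v : ℕ → ℝ × ℝ) (z : ℂ) (n : ℕ) :
    (continuant v n).eval (-z) = (-1) ^ n * (continuant v n).eval z := by
  induction n using Nat.twoStepInduction with
  | zero => simp [continuant_eval_zero]
  | one => simp [continuant_eval_one]
  | more n h1 h2 =>
    rw [continuant_eval_add_two, h1, h2, continuant_eval_add_two]
    ring

open ComplexConjugate in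
lemma re_mul_conj_step (z p q : ℂ) (x c : ℝ) :
    (q * conj (x * z * q + c ^ 2 * p)).re
      = z.re * x * Complex.normSq q + c ^ 2 * (p * conj q).re := by
  rw [← Complex.ofReal_pow]
  simp only [Complex.mul_re, Complex.conj_re, Complex.conj_im, Complex.add_re, Complex.add_im,
    Complex.mul_im, Complex.ofReal_re, Complex.ofReal_im, Complex.normSq_apply]
  ring

open ComplexConjugate in
/-- The ratio `K_{n+1} / K_n` has real part at least `z.re * m`: the half plane is preserved by
the continued fraction. -/
lemma re_continuant_mul_conj (m M : ℝ) (hm : 0 < m) (v : ℕ → ℝ × ℝ) (hv : IsBoxed m M v) (z : ℂ)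
    (hz : 0 ≤ z.re) (n : ℕ) :
    z.re * m * Complex.normSq ((continuant v n).eval z)
      ≤ ((continuant v n).eval z * conj ((continuant v (n + 1)).eval z)).re := by
  induction n with
  | zero =>
    simp only [continuant_eval_zero, zero_add, continuant_eval_one]
    simp
    nlinarith [(hv 0).1.1]
  | succ n ih =>
    rw [continuant_eval_add_two, re_mul_conj_step]
    have h1 := Complex.normSq_nonneg ((continuant v (n + 1)).eval z)
    have h2 := Complex.normSq_nonneg ((continuant v n).eval z)
    have h3 : z.re * m ≤ z.re * (v (n + 1)).1 := mul_le_mul_of_nonneg_left (hv _).1.1 hz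
    have h4 := mul_le_mul_of_nonneg_right h3 h1
    have h5 : 0 ≤ z.re * m * Complex.normSq ((continuant v n).eval z) := by positivity
    have h6 := mul_nonneg (sq_nonneg (v n).2) (h5.trans ih)
    linarith

open ComplexConjugate in
/-- The analogue of `re_continuant_mul_conj` when a weight is removed at the start. -/
lemma re_continuant_shift_mul_conj (m M : ℝ) (hm : 0 < m) (z : ℂ)
    (hz : 0 ≤ z.re) (n : ℕ) (v : ℕ → ℝ × ℝ) (hv : IsBoxed m M v) :
    z.re * m * Complex.normSq ((continuant (shift 1 v) n).eval z)
      ≤ ((continuant (shift 1 v) n).eval z * conj ((continuant v (n + 1)).eval z)).re := by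
  induction n generalizing v with
  | zero =>
    simp only [continuant_eval_zero, zero_add, continuant_eval_one]
    simp
    nlinarith [(hv 0).1.1]
  | succ n ih =>
    rw [continuant_eval_add_two_left, re_mul_conj_step]
    have h1 := Complex.normSq_nonneg ((continuant (shift 1 v) (n + 1)).eval z)
    have h2 := Complex.normSq_nonneg ((continuant (shift 2 v) n).eval z)
    have h3 : z.re * m ≤ z.re * (v 0).1 := mul_le_mul_of_nonneg_left (hv _).1.1 hz
    have h4 := mul_le_mul_of_nonneg_right h3 h1
    have h5 : 0 ≤ z.re * m * Complex.normSq ((continuant (shift 2 v) n).eval z) := by positivity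
    have hs : shift 1 (shift 1 v) = shift 2 v := by
      funext k; simp only [shift]; congr 1; omega
    have ih' := ih (shift 1 v) (hv.shift 1)
    rw [hs] at ih'
    have h6 := mul_nonneg (sq_nonneg (v 0).2) (h5.trans ih')
    linarith

open ComplexConjugate in
lemma mul_norm_le_of_re_mul_conj {p q : ℂ} {c : ℝ}
    (h : c * Complex.normSq p ≤ (p * conj q).re) : c * ‖p‖ ≤ ‖q‖ := by
  rcases eq_or_ne p 0 with rfl | hp
  · simp
  · have h1 : c * ‖p‖ * ‖p‖ ≤ ‖q‖ * ‖p‖ := by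
      calc c * ‖p‖ * ‖p‖ = c * Complex.normSq p := by rw [Complex.normSq_eq_norm_sq]; ring
        _ ≤ _ := h
        _ ≤ ‖p * conj q‖ := Complex.re_le_norm _
        _ = _ := by rw [norm_mul, Complex.norm_conj, mul_comm]
    exact le_of_mul_le_mul_right h1 (norm_pos_iff.2 hp)

lemma mul_norm_continuant_le (m M : ℝ) (hm : 0 < m) (v : ℕ → ℝ × ℝ) (hv : IsBoxed m M v) (z : ℂ)
    (hz : 0 ≤ z.re) (n : ℕ) :
    z.re * m * ‖(continuant v n).eval z‖ ≤ ‖(continuant v (n + 1)).eval z‖ :=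
  mul_norm_le_of_re_mul_conj (re_continuant_mul_conj m M hm v hv z hz n)

lemma mul_norm_continuant_shift_le (m M : ℝ) (hm : 0 < m) (v : ℕ → ℝ × ℝ) (hv : IsBoxed m M v)
    (z : ℂ) (hz : 0 ≤ z.re) (n : ℕ) :
    z.re * m * ‖(continuant (shift 1 v) n).eval z‖ ≤ ‖(continuant v (n + 1)).eval z‖ :=
  mul_norm_le_of_re_mul_conj (re_continuant_shift_mul_conj m M hm z hz n v hv)

lemma continuant_eval_ne_zero (m M : ℝ) (hm : 0 < m) (v : ℕ → ℝ × ℝ) (hv : IsBoxed m M v) (z : ℂ)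
    (hz : 0 < z.re) (n : ℕ) : (continuant v n).eval z ≠ 0 := by
  induction n with
  | zero => simp [continuant_eval_zero]
  | succ n ih =>
    have h := mul_norm_continuant_le m M hm v hv z hz.le n
    have : 0 < z.re * m * ‖(continuant v n).eval z‖ := by positivity
    exact norm_pos_iff.1 (this.trans_le h)

/-- Outside the disc of radius `2 * M / m` the continuants grow geometrically. -/
lemma mul_norm_continuant_le_of_le_norm (m M : ℝ) (hm : 0 < m) (v : ℕ → ℝ × ℝ)
    (hv : IsBoxed m M v) (z : ℂ) (hz : 2 * M / m ≤ ‖z‖) (n : ℕ) :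
    M * ‖(continuant v n).eval z‖ ≤ ‖(continuant v (n + 1)).eval z‖ := by
  have hM : 0 < M := hm.trans_le ((hv 0).1.1.trans (hv 0).1.2)
  rw [div_le_iff₀ hm] at hz
  have hx : ∀ k, 2 * M ≤ (v k).1 * ‖z‖ := fun k =>
    hz.trans (by rw [mul_comm]; exact mul_le_mul_of_nonneg_right (hv k).1.1 (norm_nonneg _))
  induction n with
  | zero =>
    simp only [continuant_eval_zero, zero_add, continuant_eval_one, norm_mul, Complex.norm_real,
      norm_one, Real.norm_eq_abs]
    rw [abs_of_pos (hm.trans_le (hv 0).1.1)]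
    linarith [hx 0]
  | succ n ih =>
    rw [continuant_eval_add_two]
    have h1 : ‖((v n).2 : ℂ) ^ 2 * (continuant v n).eval z‖
        ≤ M * ‖(continuant v (n + 1)).eval z‖ := by
      rw [norm_mul, norm_pow, Complex.norm_real, Real.norm_eq_abs,
        abs_of_pos (hm.trans_le (hv n).2.1)]
      have : (v n).2 ^ 2 ≤ M ^ 2 :=
        pow_le_pow_left₀ (hm.le.trans (hv n).2.1) (hv n).2.2 2
      calc (v n).2 ^ 2 * ‖(continuant v n).eval z‖ ≤ M ^ 2 * ‖(continuant v n).eval z‖ := by gcongr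
        _ = M * (M * ‖(continuant v n).eval z‖) := by ring
        _ ≤ _ := by gcongr
    have h2 : 2 * M * ‖(continuant v (n + 1)).eval z‖
        ≤ ‖((v (n + 1)).1 : ℂ) * z * (continuant v (n + 1)).eval z‖ := by
      rw [norm_mul, norm_mul, Complex.norm_real, Real.norm_eq_abs,
        abs_of_pos (hm.trans_le (hv _).1.1)]
      exact mul_le_mul_of_nonneg_right (hx _) (norm_nonneg _)
    have h3 := norm_sub_le_norm_add (((v (n + 1)).1 : ℂ) * z * (continuant v (n + 1)).eval z)
      (((v n).2 : ℂ) ^ 2 * (continuant v n).eval z)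
    linarith

lemma continuant_eval_ne_zero_of_le_norm (m M : ℝ) (hm : 0 < m) (v : ℕ → ℝ × ℝ)
    (hv : IsBoxed m M v) (z : ℂ) (hz : 2 * M / m ≤ ‖z‖) (n : ℕ) :
    (continuant v n).eval z ≠ 0 := by
  have hM : 0 < M := hm.trans_le ((hv 0).1.1.trans (hv 0).1.2)
  induction n with
  | zero => simp [continuant_eval_zero]
  | succ n ih =>
    have h := mul_norm_continuant_le_of_le_norm m M hm v hv z hz n
    have : 0 < M * ‖(continuant v n).eval z‖ := by positivity
    exact norm_pos_iff.1 (this.trans_le h)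

open Polynomial in
lemma natDegree_continuant (m M : ℝ) (hm : 0 < m) (v : ℕ → ℝ × ℝ) (hv : IsBoxed m M v) (n : ℕ) :
    (continuant v n).natDegree = n ∧
      (continuant v n).leadingCoeff = ((∏ i ∈ Finset.range n, (v i).1 : ℝ) : ℂ) := by
  have hx : ∀ k, ((v k).1 : ℂ) ≠ 0 := fun k => by
    exact_mod_cast (hm.trans_le (hv k).1.1).ne'
  induction n using Nat.twoStepInduction with
  | zero => simp [continuant]
  | one => simp [continuant, natDegree_C_mul_X _ (hx 0)]
  | more n h1 h2 =>
    have h0 : continuant v (n + 1) ≠ 0 := by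
      intro h; simp [h] at h2
    have hd : (C ((v (n + 1)).1 : ℂ) * X * continuant v (n + 1)).natDegree = n + 2 := by
      rw [natDegree_mul (by simp [hx]) h0, natDegree_C_mul_X _ (hx _), h2.1]; omega
    have hlt : (C (((v n).2 : ℂ) ^ 2) * continuant v n).natDegree
        < (C ((v (n + 1)).1 : ℂ) * X * continuant v (n + 1)).natDegree := by
      refine (natDegree_C_mul_le _ _).trans_lt ?_
      rw [hd, h1.1]; omega
    constructor
    · rw [continuant, natDegree_add_eq_left_of_natDegree_lt hlt, hd]
    · rw [continuant, leadingCoeff_add_of_degree_lt' (degree_lt_degree hlt), leadingCoeff_mul, h2.2,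
        Finset.prod_range_succ _ (n + 1)]
      simp only [leadingCoeff_mul, leadingCoeff_C, leadingCoeff_X, mul_one]
      push_cast
      ring

/-- All the zeros of a continuant are purely imaginary, and they lie in a disc whose radius depends
only on the bounds of the weights. -/
lemma root_continuant (m M : ℝ) (hm : 0 < m) (v : ℕ → ℝ × ℝ) (hv : IsBoxed m M v) (n : ℕ) (r : ℂ)
    (hr : r ∈ (continuant v n).roots) : r.re = 0 ∧ r.im ^ 2 ∈ Icc 0 ((2 * M / m) ^ 2) := by
  have hM : 0 < M := hm.trans_le ((hv 0).1.1.trans (hv 0).1.2)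
  have h0 : (continuant v n).eval r = 0 := (Polynomial.mem_roots'.1 hr).2
  have hre : r.re = 0 := by
    rcases lt_trichotomy r.re 0 with h | h | h
    · have := continuant_eval_ne_zero m M hm v hv (-r) (by simpa using h) n
      rw [continuant_eval_neg, h0] at this
      simp at this
    · exact h
    · exact absurd h0 (continuant_eval_ne_zero m M hm v hv r h n)
  refine ⟨hre, sq_nonneg _, ?_⟩
  have hlt : ‖r‖ < 2 * M / m := by
    by_contra hle
    exact continuant_eval_ne_zero_of_le_norm m M hm v hv r (not_lt.1 hle) n h0
  have : r.im ^ 2 = ‖r‖ ^ 2 := by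
    rw [← Complex.normSq_eq_norm_sq, Complex.normSq_apply, hre]; ring
  rw [this]
  exact pow_le_pow_left₀ (norm_nonneg _) hlt.le 2

/-- Since `K_n` is even or odd with purely imaginary zeros `± i λ`, its modulus is a product of
factors `|z² + λ²|`. -/
lemma norm_continuant_sq (m M : ℝ) (hm : 0 < m) (v : ℕ → ℝ × ℝ) (hv : IsBoxed m M v) (n : ℕ)
    (z : ℂ) :
    ‖(continuant v n).eval z‖ ^ 2 = (∏ i ∈ Finset.range n, (v i).1) ^ 2
      * ((continuant v n).roots.map (fun r => ‖z ^ 2 + ((r.im ^ 2 : ℝ) : ℂ)‖)).prod := by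
  have hcard : Multiset.card (continuant v n).roots = (continuant v n).natDegree :=
    IsAlgClosed.card_roots_eq_natDegree
  have hfac := Polynomial.C_leadingCoeff_mul_prod_multiset_X_sub_C hcard
  have hlead := (natDegree_continuant m M hm v hv n).2
  have hev : ∀ w : ℂ, ‖(continuant v n).eval w‖ = (∏ i ∈ Finset.range n, (v i).1)
      * ((continuant v n).roots.map (fun r => ‖w - r‖)).prod := by
    intro w
    conv_lhs => rw [← hfac]
    rw [Polynomial.eval_mul, Polynomial.eval_C, norm_mul, hlead, Complex.norm_real,
      Real.norm_eq_abs, abs_of_nonneg (Finset.prod_nonneg fun i _ => hm.le.trans (hv i).1.1),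
      Polynomial.eval_multiset_prod, Multiset.map_map]
    congr 1
    have := map_multiset_prod (normHom : ℂ →*₀ ℝ)
      ((continuant v n).roots.map fun r => w - r)
    simp only [Multiset.map_map] at this
    simpa using this
  have hneg : ‖(continuant v n).eval (-z)‖ = ‖(continuant v n).eval z‖ := by
    rw [continuant_eval_neg]; simp
  calc ‖(continuant v n).eval z‖ ^ 2
      = ‖(continuant v n).eval z‖ * ‖(continuant v n).eval (-z)‖ := by rw [hneg]; ring
    _ = _ := by
      rw [hev z, hev (-z)]
      rw [mul_mul_mul_comm, ← Multiset.prod_map_mul, ← sq]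
      congr 2
      refine Multiset.map_congr rfl fun r hr => ?_
      rw [← norm_mul, ← norm_neg]
      congr 1
      have h1 := (root_continuant m M hm v hv n r hr).1
      have h2 : r = r.im * Complex.I := by
        apply Complex.ext <;> simp [h1]
      have h3 : ((r.im ^ 2 : ℝ) : ℂ) = -r ^ 2 := by
        conv_rhs => rw [h2]
        rw [mul_pow, Complex.I_sq]; push_cast; ring
      rw [h3]; ring

/-! ### Products of transfer matrices and existence of the Lyapunov exponent -/

/-- The product of the first `n` transfer matrices. -/
noncomputable def transferProd (v : ℕ → ℝ × ℝ) (z : ℂ) (n : ℕ) : Matrix (Fin 2) (Fin 2) ℂ :=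
  ((List.range n).map (fun y => transferMatrix z (v y).1 (v y).2)).prod

lemma transferProd_succ (v : ℕ → ℝ × ℝ) (z : ℂ) (n : ℕ) :
    transferProd v z (n + 1) = transferProd v z n * transferMatrix z (v n).1 (v n).2 := by
  simp [transferProd, List.range_succ]

lemma transferProd_add (v : ℕ → ℝ × ℝ) (z : ℂ) (m n : ℕ) :
    transferProd v z (m + n) = transferProd v z m * transferProd (shift m v) z n := by
  simp [transferProd, List.range_add, shift, Function.comp_def]

lemma transferProd_add_two (v : ℕ → ℝ × ℝ) (z : ℂ) (n : ℕ) :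
    transferProd v z (n + 2) =
      !![(continuant v (n + 2)).eval z,
          ((v (n + 1)).2 : ℂ) ^ 2 * (continuant v (n + 1)).eval z;
        (continuant (shift 1 v) (n + 1)).eval z,
          ((v (n + 1)).2 : ℂ) ^ 2 * (continuant (shift 1 v) n).eval z] := by
  induction n with
  | zero =>
    rw [transferProd_succ, transferProd_succ]
    simp only [continuant_eval_add_two, continuant_eval_one, continuant_eval_zero, zero_add]
    simp [transferProd, transferMatrix, shift, mul_comm, mul_assoc, mul_left_comm]
  | succ n ih =>
    rw [transferProd_succ, ih, transferMatrix, Matrix.mul_fin_two,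
      continuant_eval_add_two v z (n + 1), continuant_eval_add_two (shift 1 v) z n]
    have e1 : 1 + (n + 1) = n + 2 := by omega
    have e2 : 1 + n = n + 1 := by omega
    simp only [shift, e1, e2]
    congr 3 <;> ring_nf

lemma matNorm_fin_two (a b c d : ℂ) :
    matNorm !![a, b; c, d] = ‖a‖ + ‖b‖ + (‖c‖ + ‖d‖) := by
  simp [matNorm, Fin.sum_univ_two]

lemma matNorm_nonneg (A : Matrix (Fin 2) (Fin 2) ℂ) : 0 ≤ matNorm A :=
  Finset.sum_nonneg fun _ _ => Finset.sum_nonneg fun _ _ => norm_nonneg _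

lemma matNorm_mul_le (A B : Matrix (Fin 2) (Fin 2) ℂ) :
    matNorm (A * B) ≤ matNorm A * matNorm B := by
  simp only [matNorm, Fin.sum_univ_two, Matrix.mul_apply]
  have h : ∀ i j, ‖A i 0 * B 0 j + A i 1 * B 1 j‖ ≤ ‖A i 0‖ * ‖B 0 j‖ + ‖A i 1‖ * ‖B 1 j‖ :=
    fun i j => (norm_add_le _ _).trans (by rw [norm_mul, norm_mul])
  have h1 := h 0 0
  have h2 := h 0 1
  have h3 := h 1 0
  have h4 := h 1 1
  have p : ∀ i j k l, 0 ≤ ‖A i j‖ * ‖B k l‖ := fun i j k l => by positivity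
  nlinarith [p 0 0 1 0, p 0 0 1 1, p 0 1 0 0, p 0 1 0 1, p 1 0 1 0, p 1 0 1 1, p 1 1 0 0, p 1 1 0 1]

lemma norm_det_le_matNorm_sq (A : Matrix (Fin 2) (Fin 2) ℂ) : ‖A.det‖ ≤ matNorm A ^ 2 := by
  rw [Matrix.det_fin_two]
  simp only [matNorm, Fin.sum_univ_two]
  refine (norm_sub_le _ _).trans ?_
  rw [norm_mul, norm_mul]
  have p : ∀ i j, 0 ≤ ‖A i j‖ := fun i j => norm_nonneg _
  nlinarith [mul_nonneg (p 0 0) (p 1 1), mul_nonneg (p 0 1) (p 1 0), mul_nonneg (p 0 0) (p 0 1),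
    mul_nonneg (p 0 0) (p 1 0), mul_nonneg (p 0 1) (p 1 1), mul_nonneg (p 1 0) (p 1 1),
    sq_nonneg ‖A 0 0‖, sq_nonneg ‖A 0 1‖, sq_nonneg ‖A 1 0‖, sq_nonneg ‖A 1 1‖]

lemma pow_le_matNorm (m M : ℝ) (hm : 0 < m) (v : ℕ → ℝ × ℝ) (hv : IsBoxed m M v) (z : ℂ) (n : ℕ) :
    m ^ n ≤ matNorm (transferProd v z n) := by
  have hdet : (m ^ n) ^ 2 ≤ ‖(transferProd v z n).det‖ := by
    induction n with
    | zero => simp [transferProd]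
    | succ n ih =>
      rw [transferProd_succ, Matrix.det_mul, norm_mul, pow_succ m, mul_pow]
      refine mul_le_mul ih ?_ (by positivity) (norm_nonneg _)
      simp only [transferMatrix, Matrix.det_fin_two_of, mul_zero, mul_one, zero_sub, norm_neg,
        norm_pow, Complex.norm_real, Real.norm_eq_abs, sq_abs]
      exact pow_le_pow_left₀ hm.le (hv n).2.1 2
  exact (sq_le_sq₀ (by positivity) (matNorm_nonneg _)).1
    (hdet.trans (norm_det_le_matNorm_sq _))

lemma matNorm_le_pow (m M : ℝ) (hm : 0 < m) (v : ℕ → ℝ × ℝ) (hv : IsBoxed m M v) (z : ℂ) (n : ℕ) :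
    matNorm (transferProd v z n) ≤ 2 * (‖z‖ * M + M ^ 2 + 1) ^ n := by
  have hM : 0 < M := hm.trans_le ((hv 0).1.1.trans (hv 0).1.2)
  induction n with
  | zero =>
    have : matNorm (1 : Matrix (Fin 2) (Fin 2) ℂ) = 2 := by
      rw [Matrix.one_fin_two, matNorm_fin_two]; norm_num
    simp [transferProd, this]
  | succ n ih =>
    rw [transferProd_succ, pow_succ, ← mul_assoc]
    refine (matNorm_mul_le _ _).trans (mul_le_mul ih ?_ (matNorm_nonneg _) (by positivity))
    rw [transferMatrix, matNorm_fin_two]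
    simp only [norm_mul, Complex.norm_real, norm_pow, norm_one, norm_zero, Real.norm_eq_abs,
      sq_abs]
    rw [abs_of_pos (hm.trans_le (hv n).1.1)]
    have h1 : ‖z‖ * (v n).1 ≤ ‖z‖ * M := mul_le_mul_of_nonneg_left (hv n).1.2 (norm_nonneg _)
    have h2 : (v n).2 ^ 2 ≤ M ^ 2 := pow_le_pow_left₀ (hm.le.trans (hv n).2.1) (hv n).2.2 2
    linarith

lemma matNorm_transferProd_pos (m M : ℝ) (hm : 0 < m) (v : ℕ → ℝ × ℝ) (hv : IsBoxed m M v) (z : ℂ)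
    (n : ℕ) : 0 < matNorm (transferProd v z n) :=
  (pow_pos hm n).trans_le (pow_le_matNorm m M hm v hv z n)

lemma log_matNorm_mem (m M : ℝ) (hm : 0 < m) (v : ℕ → ℝ × ℝ) (hv : IsBoxed m M v) (z : ℂ) (n : ℕ) :
    n * Real.log m ≤ Real.log (matNorm (transferProd v z n)) ∧
    Real.log (matNorm (transferProd v z n))
      ≤ Real.log 2 + n * Real.log (‖z‖ * M + M ^ 2 + 1) := by
  have hM : 0 < M := hm.trans_le ((hv 0).1.1.trans (hv 0).1.2)
  constructor
  · rw [← Real.log_pow]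
    exact Real.log_le_log (pow_pos hm n) (pow_le_matNorm m M hm v hv z n)
  · rw [← Real.log_pow, ← Real.log_mul (by norm_num) (by positivity)]
    exact Real.log_le_log (matNorm_transferProd_pos m M hm v hv z n)
      (matNorm_le_pow m M hm v hv z n)

lemma measurable_matNorm_transferProd (z : ℂ) (n : ℕ) :
    Measurable fun v : ℕ → ℝ × ℝ => matNorm (transferProd v z n) := by
  have h : ∀ i j, Measurable fun v : ℕ → ℝ × ℝ => transferProd v z n i j := by
    induction n with
    | zero => intro i j; simp [transferProd]
    | succ n ih =>
      intro i j
      simp only [transferProd_succ, Matrix.mul_apply, Fin.sum_univ_two]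
      have ht : ∀ k, Measurable fun v : ℕ → ℝ × ℝ =>
          transferMatrix z (v n).1 (v n).2 k j := by
        intro k
        have h1 : Measurable fun v : ℕ → ℝ × ℝ => z * ((v n).1 : ℂ) :=
          (Complex.measurable_ofReal.comp (measurable_pi_apply n).fst).const_mul z
        have h2 : Measurable fun v : ℕ → ℝ × ℝ => ((v n).2 : ℂ) ^ 2 :=
          (Complex.measurable_ofReal.comp (measurable_pi_apply n).snd).pow_const 2
        fin_cases k <;> fin_cases j <;> simp [transferMatrix, h1, h2]
      exact ((ih i 0).mul (ht 0)).add ((ih i 1).mul (ht 1))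
  simp only [matNorm]
  exact Finset.measurable_sum _ fun i _ => Finset.measurable_sum _ fun j _ => (h i j).norm

lemma measurable_continuant_eval (z : ℂ) (n : ℕ) :
    Measurable fun v : ℕ → ℝ × ℝ => (continuant v n).eval z := by
  induction n using Nat.twoStepInduction with
  | zero => simp [continuant_eval_zero]
  | one =>
    simp only [continuant_eval_one]
    exact (Complex.measurable_ofReal.comp (measurable_pi_apply 0).fst).mul_const z
  | more n h1 h2 =>
    simp only [continuant_eval_add_two]
    exact (((Complex.measurable_ofReal.comp (measurable_pi_apply (n + 1)).fst).mul_const z).mul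
      h2).add (((Complex.measurable_ofReal.comp (measurable_pi_apply n).snd).pow_const 2).mul h1)

section Disorder

variable {Ω : Type*} [MeasurableSpace Ω] {P : Measure Ω} {w₁ w₂ : ℕ → Ω → ℝ}

/-- The sequence of weights at a sample point. -/
def weights (w₁ w₂ : ℕ → Ω → ℝ) (ω : Ω) : ℕ → ℝ × ℝ := fun y => (w₁ y ω, w₂ y ω)

lemma IsDisorder.measurable_weights (hw : IsDisorder P w₁ w₂) : Measurable (weights w₁ w₂) :=
  measurable_pi_lambda _ fun y => (hw.measurable_fst y).prodMk (hw.measurable_snd y)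

lemma exists_Icc_of_isCompact {K : Set ℝ} (hK : IsCompact K) (h0 : K ⊆ Ioi 0) :
    ∃ m M : ℝ, 0 < m ∧ K ⊆ Icc m M := by
  rcases K.eq_empty_or_nonempty with rfl | hne
  · exact ⟨1, 1, one_pos, empty_subset _⟩
  · exact ⟨sInf K, sSup K, h0 (hK.sInf_mem hne),
      fun x hx => ⟨csInf_le hK.bddBelow hx, le_csSup hK.bddAbove hx⟩⟩

lemma IsDisorder.exists_isBoxed (hw : IsDisorder P w₁ w₂) :
    ∃ m M : ℝ, 0 < m ∧ ∀ᵐ ω ∂P, IsBoxed m M (weights w₁ w₂ ω) := by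
  obtain ⟨K₁, hK₁, hK₁0, h₁⟩ := hw.compact_fst
  obtain ⟨K₂, hK₂, hK₂0, h₂⟩ := hw.compact_snd
  obtain ⟨m₁, M₁, hm₁, hs₁⟩ := exists_Icc_of_isCompact hK₁ hK₁0
  obtain ⟨m₂, M₂, hm₂, hs₂⟩ := exists_Icc_of_isCompact hK₂ hK₂0
  refine ⟨min m₁ m₂, max M₁ M₂, lt_min hm₁ hm₂, ae_all_iff.2 fun y => ?_⟩
  have hS : MeasurableSet (Icc m₁ M₁ ×ˢ Icc m₂ M₂) := measurableSet_Icc.prod measurableSet_Icc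
  have h : ∀ᵐ ω ∂P, (w₁ 0 ω, w₂ 0 ω) ∈ Icc m₁ M₁ ×ˢ Icc m₂ M₂ := by
    filter_upwards [h₁, h₂] with ω a b
    exact ⟨hs₁ a, hs₂ b⟩
  filter_upwards [(hw.identDistrib y).symm.ae_mem_snd hS h] with ω hω
  exact ⟨⟨(min_le_left _ _).trans hω.1.1, hω.1.2.trans (le_max_left _ _)⟩,
    (min_le_right _ _).trans hω.2.1, hω.2.2.trans (le_max_right _ _)⟩

lemma IsDisorder.identDistrib_shift (hw : IsDisorder P w₁ w₂) (k : ℕ) :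
    IdentDistrib (fun ω => shift k (weights w₁ w₂ ω)) (weights w₁ w₂) P P := by
  have h := IdentDistrib.pi (X := fun n ω => (w₁ (k + n) ω, w₂ (k + n) ω))
    (Y := fun n ω => (w₁ n ω, w₂ n ω))
    (fun n => (hw.identDistrib (k + n)).trans (hw.identDistrib n).symm)
    (hw.iIndep.precomp (g := fun n => k + n) (add_right_injective k)) hw.iIndep
  exact h

lemma IsDisorder.integrable_log_matNorm [IsProbabilityMeasure P] (hw : IsDisorder P w₁ w₂) (z : ℂ)
    (n : ℕ) : Integrable (fun ω => Real.log (matNorm (transferProd (weights w₁ w₂ ω) z n))) P := by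
  obtain ⟨m, M, hm, hb⟩ := hw.exists_isBoxed
  refine Integrable.of_mem_Icc (n * Real.log m) (Real.log 2 + n * Real.log (‖z‖ * M + M ^ 2 + 1))
    ((Real.measurable_log.comp (measurable_matNorm_transferProd z n)).comp
      hw.measurable_weights).aemeasurable ?_
  filter_upwards [hb] with ω hω
  exact log_matNorm_mem m M hm _ hω z n

/-- The Lyapunov exponent exists for every `z`, by Fekete's subadditive lemma. -/
lemma IsDisorder.tendsto_meanLogGrowth [IsProbabilityMeasure P] (hw : IsDisorder P w₁ w₂) (z : ℂ) :
    Tendsto (meanLogGrowth P (fun y ω => transferMatrix z (w₁ y ω) (w₂ y ω))) atTop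
      (𝓝 (lyap P w₁ w₂ z)) := by
  obtain ⟨m, M, hm, hb⟩ := hw.exists_isBoxed
  set u : ℕ → ℝ := fun n => ∫ ω, Real.log (matNorm (transferProd (weights w₁ w₂ ω) z n)) ∂P with hu
  have hsub : Subadditive u := by
    intro k n
    have hmeas : Measurable fun v : ℕ → ℝ × ℝ => Real.log (matNorm (transferProd v z n)) :=
      Real.measurable_log.comp (measurable_matNorm_transferProd z n)
    have hid := (hw.identDistrib_shift k).comp hmeas
    have hint : Integrable
        (fun ω => Real.log (matNorm (transferProd (shift k (weights w₁ w₂ ω)) z n))) P :=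
      hid.integrable_iff.2 (hw.integrable_log_matNorm z n)
    have heq : ∫ ω, Real.log (matNorm (transferProd (shift k (weights w₁ w₂ ω)) z n)) ∂P = u n :=
      hid.integral_eq
    rw [← heq, ← integral_add (hw.integrable_log_matNorm z k) hint]
    refine integral_mono_ae (hw.integrable_log_matNorm z (k + n))
      ((hw.integrable_log_matNorm z k).add hint) ?_
    filter_upwards [hb] with ω hω
    have h1 := matNorm_transferProd_pos m M hm _ hω z k
    have h2 := matNorm_transferProd_pos m M hm _ (hω.shift k) z n
    change _ ≤ Real.log _ + Real.log _
    rw [← Real.log_mul h1.ne' h2.ne']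
    refine Real.log_le_log (matNorm_transferProd_pos m M hm _ hω z _) ?_
    rw [transferProd_add]
    exact matNorm_mul_le _ _
  have hbdd : BddBelow (range fun n : ℕ => u n / n) := by
    refine ⟨min (Real.log m) 0, ?_⟩
    rintro _ ⟨n, rfl⟩
    rcases Nat.eq_zero_or_pos n with rfl | hn
    · simp
    · have hn' : (0 : ℝ) < n := by exact_mod_cast hn
      refine (min_le_left _ _).trans ((le_div_iff₀ hn').2 ?_)
      have h := integral_mono_ae (μ := P) (integrable_const (n * Real.log m))
        (hw.integrable_log_matNorm z n)
        (by filter_upwards [hb] with ω hω using (log_matNorm_mem m M hm _ hω z n).1)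
      rw [integral_const, probReal_univ, one_smul] at h
      rw [mul_comm]; exact h
  have hlim := hsub.tendsto_lim hbdd
  have hfun : meanLogGrowth P (fun y ω => transferMatrix z (w₁ y ω) (w₂ y ω))
      = fun n : ℕ => u n / n := by
    funext n
    simp only [meanLogGrowth, hu, transferProd, weights]
    ring
  rw [lyap, topLyapunov, hfun, hlim.limUnder_eq]
  exact hlim

end Disorder

/-! ### Functions with uniform Taylor estimates -/

/-- Taylor estimates on `S`, with constant `C`, expressing that `f₁` and `f₂` are the first two
derivatives of `f` and that `f₂` is Lipschitz. They are stated as inequalities between values, so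
that they pass to sums, expectations and pointwise limits. -/
structure JetBound (C : ℝ) (S : Set ℝ) (f f₁ f₂ : ℝ → ℝ) : Prop where
  abs_zero : ∀ x ∈ S, |f x| ≤ C
  abs_one : ∀ x ∈ S, |f₁ x| ≤ C
  abs_two : ∀ x ∈ S, |f₂ x| ≤ C
  taylor_zero : ∀ x ∈ S, ∀ y ∈ S, |f y - f x - f₁ x * (y - x)| ≤ C * (y - x) ^ 2
  taylor_one : ∀ x ∈ S, ∀ y ∈ S, |f₁ y - f₁ x - f₂ x * (y - x)| ≤ C * (y - x) ^ 2
  lip_two : ∀ x ∈ S, ∀ y ∈ S, |f₂ y - f₂ x| ≤ C * |y - x|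

lemma JetBound.add {C C' : ℝ} {S : Set ℝ} {f f₁ f₂ g g₁ g₂ : ℝ → ℝ}
    (hf : JetBound C S f f₁ f₂) (hg : JetBound C' S g g₁ g₂) :
    JetBound (C + C') S (fun x => f x + g x) (fun x => f₁ x + g₁ x) (fun x => f₂ x + g₂ x) where
  abs_zero x hx := (abs_add_le _ _).trans (add_le_add (hf.abs_zero x hx) (hg.abs_zero x hx))
  abs_one x hx := (abs_add_le _ _).trans (add_le_add (hf.abs_one x hx) (hg.abs_one x hx))
  abs_two x hx := (abs_add_le _ _).trans (add_le_add (hf.abs_two x hx) (hg.abs_two x hx))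
  taylor_zero x hx y hy := by
    rw [add_mul C C']
    refine le_trans (le_of_eq ?_) ((abs_add_le _ _).trans
      (add_le_add (hf.taylor_zero x hx y hy) (hg.taylor_zero x hx y hy)))
    congr 1; ring
  taylor_one x hx y hy := by
    rw [add_mul C C']
    refine le_trans (le_of_eq ?_) ((abs_add_le _ _).trans
      (add_le_add (hf.taylor_one x hx y hy) (hg.taylor_one x hx y hy)))
    congr 1; ring
  lip_two x hx y hy := by
    rw [add_mul C C']
    refine le_trans (le_of_eq ?_) ((abs_add_le _ _).trans
      (add_le_add (hf.lip_two x hx y hy) (hg.lip_two x hx y hy)))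
    congr 1; ring

lemma JetBound.const_mul {C k : ℝ} (hk : 0 ≤ k) {S : Set ℝ} {f f₁ f₂ : ℝ → ℝ}
    (hf : JetBound C S f f₁ f₂) :
    JetBound (k * C) S (fun x => k * f x) (fun x => k * f₁ x) (fun x => k * f₂ x) := by
  have key : ∀ {u B : ℝ}, |u| ≤ B → |k * u| ≤ k * B := fun h => by
    rw [abs_mul, abs_of_nonneg hk]; exact mul_le_mul_of_nonneg_left h hk
  constructor
  · exact fun x hx => key (hf.abs_zero x hx)
  · exact fun x hx => key (hf.abs_one x hx)
  · exact fun x hx => key (hf.abs_two x hx)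
  · intro x hx y hy
    rw [mul_assoc k C]
    refine le_trans (le_of_eq ?_) (key (hf.taylor_zero x hx y hy))
    congr 1; ring
  · intro x hx y hy
    rw [mul_assoc k C]
    refine le_trans (le_of_eq ?_) (key (hf.taylor_one x hx y hy))
    congr 1; ring
  · intro x hx y hy
    rw [mul_assoc k C]
    refine le_trans (le_of_eq ?_) (key (hf.lip_two x hx y hy))
    congr 1; ring

lemma JetBound.const (κ : ℝ) (S : Set ℝ) :
    JetBound |κ| S (fun _ => κ) (fun _ => 0) (fun _ => 0) where
  abs_zero _ _ := le_rfl
  abs_one _ _ := by simp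
  abs_two _ _ := by simp
  taylor_zero x _ y _ := by simp; positivity
  taylor_one x _ y _ := by simp; positivity
  lip_two x _ y _ := by simp; positivity

lemma JetBound.mono {C C' : ℝ} (h : C ≤ C') {S : Set ℝ} {f f₁ f₂ : ℝ → ℝ}
    (hf : JetBound C S f f₁ f₂) : JetBound C' S f f₁ f₂ where
  abs_zero x hx := (hf.abs_zero x hx).trans h
  abs_one x hx := (hf.abs_one x hx).trans h
  abs_two x hx := (hf.abs_two x hx).trans h
  taylor_zero x hx y hy := (hf.taylor_zero x hx y hy).trans (by gcongr)
  taylor_one x hx y hy := (hf.taylor_one x hx y hy).trans (by gcongr)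
  lip_two x hx y hy := (hf.lip_two x hx y hy).trans (by gcongr)

lemma JetBound.of_congr {C : ℝ} {S : Set ℝ} {f g f₁ f₂ : ℝ → ℝ}
    (hf : JetBound C S f f₁ f₂) (h : ∀ x ∈ S, g x = f x) : JetBound C S g f₁ f₂ where
  abs_zero x hx := by rw [h x hx]; exact hf.abs_zero x hx
  abs_one := hf.abs_one
  abs_two := hf.abs_two
  taylor_zero x hx y hy := by rw [h x hx, h y hy]; exact hf.taylor_zero x hx y hy
  taylor_one := hf.taylor_one
  lip_two := hf.lip_two

lemma hasDerivAt_of_taylor {C x : ℝ} {S : Set ℝ} {f : ℝ → ℝ} {f' : ℝ} (hS : S ∈ 𝓝 x)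
    (h : ∀ y ∈ S, |f y - f x - f' * (y - x)| ≤ C * (y - x) ^ 2) : HasDerivAt f f' x := by
  rw [hasDerivAt_iff_isLittleO]
  have h1 : (fun y => f y - f x - (y - x) • f') =O[𝓝 x] fun y => (y - x) ^ 2 := by
    refine Asymptotics.IsBigO.of_bound C ?_
    filter_upwards [hS] with y hy
    rw [smul_eq_mul, mul_comm, Real.norm_eq_abs, Real.norm_eq_abs,
      abs_of_nonneg (sq_nonneg (y - x))]
    exact h y hy
  refine h1.trans_isLittleO ?_
  have h2 : Tendsto (fun y : ℝ => y - x) (𝓝 x) (𝓝 0) := by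
    have h : Continuous fun y : ℝ => y - x := by fun_prop
    simpa using h.tendsto x
  exact (Asymptotics.isLittleO_pow_id (𝕜 := ℝ) one_lt_two).comp_tendsto h2

lemma JetBound.hasDerivAt {C x : ℝ} {S : Set ℝ} {f f₁ f₂ : ℝ → ℝ} (hf : JetBound C S f f₁ f₂)
    (hS : S ∈ 𝓝 x) : HasDerivAt f (f₁ x) x :=
  hasDerivAt_of_taylor hS (hf.taylor_zero x (mem_of_mem_nhds hS))

lemma JetBound.hasDerivAt_one {C x : ℝ} {S : Set ℝ} {f f₁ f₂ : ℝ → ℝ} (hf : JetBound C S f f₁ f₂)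
    (hS : S ∈ 𝓝 x) : HasDerivAt f₁ (f₂ x) x :=
  hasDerivAt_of_taylor hS (hf.taylor_one x (mem_of_mem_nhds hS))

lemma JetBound.continuousAt_two {C x : ℝ} {S : Set ℝ} {f f₁ f₂ : ℝ → ℝ}
    (hf : JetBound C S f f₁ f₂) (hS : S ∈ 𝓝 x) : ContinuousAt f₂ x := by
  rw [ContinuousAt, tendsto_iff_dist_tendsto_zero]
  have h0 : Tendsto (fun y => C * |y - x|) (𝓝 x) (𝓝 0) := by
    have : Continuous fun y : ℝ => C * |y - x| := by fun_prop
    simpa using this.tendsto x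
  refine squeeze_zero' (Eventually.of_forall fun y => dist_nonneg) ?_ h0
  filter_upwards [hS] with y hy
  rw [Real.dist_eq]
  exact hf.lip_two x (mem_of_mem_nhds hS) y hy

/-- Three bounded derivatives give the Taylor estimates. -/
lemma jetBound_of_hasDerivAt {C : ℝ} {S : Set ℝ} (hS : Convex ℝ S) {f f₁ f₂ f₃ : ℝ → ℝ}
    (h0 : ∀ x ∈ S, HasDerivAt f (f₁ x) x) (h1 : ∀ x ∈ S, HasDerivAt f₁ (f₂ x) x)
    (h2 : ∀ x ∈ S, HasDerivAt f₂ (f₃ x) x) (b0 : ∀ x ∈ S, |f x| ≤ C) (b1 : ∀ x ∈ S, |f₁ x| ≤ C)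
    (b2 : ∀ x ∈ S, |f₂ x| ≤ C) (b3 : ∀ x ∈ S, |f₃ x| ≤ C) : JetBound C S f f₁ f₂ := by
  have lip : ∀ {g g' : ℝ → ℝ}, (∀ x ∈ S, HasDerivAt g (g' x) x) → (∀ x ∈ S, |g' x| ≤ C) →
      ∀ x ∈ S, ∀ y ∈ S, |g y - g x| ≤ C * |y - x| := fun hd hb x hx y hy =>
    hS.norm_image_sub_le_of_norm_hasDerivWithin_le (fun z hz => (hd z hz).hasDerivWithinAt)
      hb hx hy
  -- The derivative of `y ↦ g y - g x - g' x * (y - x)` is at most `C * |y - x|` in size on the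
  -- segment between `x` and `y`.
  have taylor : ∀ {g g' : ℝ → ℝ}, (∀ x ∈ S, HasDerivAt g (g' x) x) →
      (∀ x ∈ S, ∀ y ∈ S, |g' y - g' x| ≤ C * |y - x|) →
      ∀ x ∈ S, ∀ y ∈ S, |g y - g x - g' x * (y - x)| ≤ C * (y - x) ^ 2 := by
    intro g g' hd hl x hx y hy
    have hC : 0 ≤ C := (abs_nonneg _).trans (b0 x hx)
    have hsub : segment ℝ x y ⊆ S := hS.segment_subset hx hy
    have hder : ∀ u ∈ segment ℝ x y, HasDerivWithinAt (fun u => g u - g' x * u)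
        (g' u - g' x) (segment ℝ x y) u := fun u hu => by
      have := (hd u (hsub hu)).fun_sub ((hasDerivAt_id' u).const_mul (g' x))
      simpa using this.hasDerivWithinAt
    have hbd : ∀ u ∈ segment ℝ x y, ‖g' u - g' x‖ ≤ C * |y - x| := fun u hu => by
      refine (hl x hx u (hsub hu)).trans (mul_le_mul_of_nonneg_left ?_ hC)
      have := norm_sub_le_of_mem_segment hu
      simpa [Real.norm_eq_abs] using this
    have := (convex_segment x y).norm_image_sub_le_of_norm_hasDerivWithin_le hder hbd
      (left_mem_segment ℝ x y) (right_mem_segment ℝ x y)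
    rw [Real.norm_eq_abs, Real.norm_eq_abs, mul_assoc, abs_mul_abs_self, ← sq] at this
    refine le_trans (le_of_eq ?_) this
    congr 1; ring
  exact ⟨b0, b1, b2, taylor h0 (lip h1 b2), taylor h1 (lip h2 b3), lip h2 b3⟩

/-- The properties of a function on `(0, π)` from which the theorem follows: `f₁`, `f₂` are its
first two derivatives, with estimates on compact subintervals, `f₁ ≥ c` on `(0, π/2)`, and `π/2`
is a critical point where the second derivative is at most `-d`. For given `C`, `c` and `d`, these
properties pass to averages, expectations and pointwise limits. -/
structure IsProfile (C : ℝ → ℝ → ℝ) (c : ℝ → ℝ) (d : ℝ) (f f₁ f₂ : ℝ → ℝ) : Prop where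
  jet : ∀ α β, 0 < α → β < Real.pi → JetBound (C α β) (Ioo α β) f f₁ f₂
  pos : ∀ θ ∈ Ioo 0 (Real.pi / 2), c θ ≤ f₁ θ
  crit : f₁ (Real.pi / 2) = 0
  neg : f₂ (Real.pi / 2) ≤ -d

/-- Any two points of `(0, π)` lie in a compactly contained subinterval. -/
lemma exists_Ioo_mem {x y : ℝ} (hx : x ∈ Ioo 0 Real.pi) (hy : y ∈ Ioo 0 Real.pi) :
    ∃ α β, 0 < α ∧ β < Real.pi ∧ x ∈ Ioo α β ∧ y ∈ Ioo α β := by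
  refine ⟨min x y / 2, (max x y + Real.pi) / 2, ?_, ?_, ⟨?_, ?_⟩, ⟨?_, ?_⟩⟩ <;>
  rcases le_total x y with h | h <;> simp only [min_eq_left, min_eq_right, max_eq_left,
    max_eq_right, h] <;> linarith [hx.1, hx.2, hy.1, hy.2]

section Profile

variable {C C' : ℝ → ℝ → ℝ} {c c' : ℝ → ℝ} {d d' : ℝ} {f f₁ f₂ g g₁ g₂ : ℝ → ℝ}

lemma IsProfile.exists_jet (hf : IsProfile C c d f f₁ f₂) {x : ℝ} (hx : x ∈ Ioo 0 Real.pi) :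
    ∃ K S, S ∈ 𝓝 x ∧ JetBound K S f f₁ f₂ := by
  obtain ⟨α, β, hα, hβ, h, -⟩ := exists_Ioo_mem hx hx
  exact ⟨_, _, Ioo_mem_nhds h.1 h.2, hf.jet α β hα hβ⟩

lemma IsProfile.hasDerivAt (hf : IsProfile C c d f f₁ f₂) {x : ℝ} (hx : x ∈ Ioo 0 Real.pi) :
    HasDerivAt f (f₁ x) x := by
  obtain ⟨K, S, hS, h⟩ := hf.exists_jet hx
  exact h.hasDerivAt hS

lemma IsProfile.hasDerivAt_one (hf : IsProfile C c d f f₁ f₂) {x : ℝ} (hx : x ∈ Ioo 0 Real.pi) :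
    HasDerivAt f₁ (f₂ x) x := by
  obtain ⟨K, S, hS, h⟩ := hf.exists_jet hx
  exact h.hasDerivAt_one hS

lemma IsProfile.continuousAt_two (hf : IsProfile C c d f f₁ f₂) {x : ℝ} (hx : x ∈ Ioo 0 Real.pi) :
    ContinuousAt f₂ x := by
  obtain ⟨K, S, hS, h⟩ := hf.exists_jet hx
  exact h.continuousAt_two hS

lemma IsProfile.add (hf : IsProfile C c d f f₁ f₂) (hg : IsProfile C' c' d' g g₁ g₂) :
    IsProfile (fun α β => C α β + C' α β) (fun θ => c θ + c' θ) (d + d') (fun x => f x + g x)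
      (fun x => f₁ x + g₁ x) (fun x => f₂ x + g₂ x) where
  jet α β hα hβ := (hf.jet α β hα hβ).add (hg.jet α β hα hβ)
  pos θ hθ := add_le_add (hf.pos θ hθ) (hg.pos θ hθ)
  crit := by rw [hf.crit, hg.crit, add_zero]
  neg := by linarith [hf.neg, hg.neg]

lemma IsProfile.const_mul {k : ℝ} (hk : 0 ≤ k) (hf : IsProfile C c d f f₁ f₂) :
    IsProfile (fun α β => k * C α β) (fun θ => k * c θ) (k * d) (fun x => k * f x)
      (fun x => k * f₁ x) (fun x => k * f₂ x) where
  jet α β hα hβ := (hf.jet α β hα hβ).const_mul hk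
  pos θ hθ := mul_le_mul_of_nonneg_left (hf.pos θ hθ) hk
  crit := by rw [hf.crit, mul_zero]
  neg := by rw [← mul_neg]; exact mul_le_mul_of_nonneg_left hf.neg hk

lemma IsProfile.const (κ : ℝ) :
    IsProfile (fun _ _ => |κ|) (fun _ => 0) 0 (fun _ => κ) (fun _ => 0) (fun _ => 0) where
  jet α β _ _ := JetBound.const κ _
  pos θ _ := le_rfl
  crit := rfl
  neg := by simp

lemma IsProfile.mono (hf : IsProfile C c d f f₁ f₂) (hC : ∀ α β, C α β ≤ C' α β)
    (hc : ∀ θ, c' θ ≤ c θ) (hd : d' ≤ d) : IsProfile C' c' d' f f₁ f₂ where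
  jet α β hα hβ := (hf.jet α β hα hβ).mono (hC α β)
  pos θ hθ := (hc θ).trans (hf.pos θ hθ)
  crit := hf.crit
  neg := hf.neg.trans (neg_le_neg hd)

lemma IsProfile.of_congr (hf : IsProfile C c d f f₁ f₂) (h : ∀ θ ∈ Ioo 0 Real.pi, g θ = f θ) :
    IsProfile C c d g f₁ f₂ where
  jet α β hα hβ := (hf.jet α β hα hβ).of_congr fun x hx => h x ⟨hα.trans hx.1, hx.2.trans hβ⟩
  pos := hf.pos
  crit := hf.crit
  neg := hf.neg

lemma IsProfile.multiset_sum {ι : Type*} (s : Multiset ι) {F F₁ F₂ : ι → ℝ → ℝ}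
    (h : ∀ i ∈ s, IsProfile C c d (F i) (F₁ i) (F₂ i)) :
    IsProfile (fun α β => s.card * C α β) (fun θ => s.card * c θ) (s.card * d)
      (fun x => (s.map fun i => F i x).sum) (fun x => (s.map fun i => F₁ i x).sum)
      (fun x => (s.map fun i => F₂ i x).sum) := by
  induction s using Multiset.induction_on with
  | empty => simpa using IsProfile.const 0
  | cons i s ih =>
    have h1 := (h i (Multiset.mem_cons_self i s)).add
      (ih fun j hj => h j (Multiset.mem_cons_of_mem hj))
    simp only [Multiset.map_cons, Multiset.sum_cons, Multiset.card_cons]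
    refine h1.mono (fun α β => le_of_eq ?_) (fun θ => le_of_eq ?_) (le_of_eq ?_) <;>
    · push_cast; ring

lemma aemeasurable_of_hasDerivAt {Ω : Type*} [MeasurableSpace Ω] {P : Measure Ω}
    {G G' : Ω → ℝ → ℝ} (hG : ∀ x ∈ Ioo 0 Real.pi, AEMeasurable (fun ω => G ω x) P)
    (hd : ∀ x ∈ Ioo 0 Real.pi, ∀ᵐ ω ∂P, HasDerivAt (G ω) (G' ω x) x) (x : ℝ)
    (hx : x ∈ Ioo 0 Real.pi) : AEMeasurable (fun ω => G' ω x) P := by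
  set ε : ℕ → ℝ := fun n => (Real.pi - x) * (1 / 2) ^ (n + 1) with hε
  have hpos : ∀ n, 0 < ε n := fun n => mul_pos (by linarith [hx.2]) (by positivity)
  have hlt : ∀ n, x + ε n < Real.pi := fun n => by
    have : ((1 : ℝ) / 2) ^ (n + 1) < 1 := pow_lt_one₀ (by norm_num) (by norm_num) (by omega)
    have := mul_lt_mul_of_pos_left this (by linarith [hx.2] : 0 < Real.pi - x)
    simp only [hε]; linarith
  have hlim : Tendsto (fun n => x + ε n) atTop (𝓝[≠] x) := by
    refine tendsto_nhdsWithin_iff.2 ⟨?_, Eventually.of_forall fun n => ?_⟩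
    · have h1 : Tendsto (fun n : ℕ => ((1 : ℝ) / 2) ^ (n + 1)) atTop (𝓝 0) :=
        (tendsto_pow_atTop_nhds_zero_of_lt_one (by norm_num) (by norm_num)).comp
          (tendsto_add_atTop_nat 1)
      simpa [hε] using (h1.const_mul (Real.pi - x)).const_add x
    · simpa using (hpos n).ne'
  refine aemeasurable_of_tendsto_metrizable_ae atTop
    (f := fun n ω => (ε n)⁻¹ * (G ω (x + ε n) - G ω x)) (fun n => ?_) ?_
  · exact ((hG _ ⟨by linarith [hpos n, hx.1], hlt n⟩).sub (hG x hx)).const_mul _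
  · filter_upwards [hd x hx] with ω hω
    have := hω.tendsto_slope.comp hlim
    simpa [Function.comp_def, slope_def_field, div_eq_inv_mul] using this

/-- Profiles with common constants are stable under expectation. -/
lemma IsProfile.integral {Ω : Type*} [MeasurableSpace Ω] {P : Measure Ω} [IsProbabilityMeasure P]
    {F F₁ F₂ : Ω → ℝ → ℝ} (hF : ∀ x ∈ Ioo 0 Real.pi, AEMeasurable (fun ω => F ω x) P)
    (h : ∀ᵐ ω ∂P, IsProfile C c d (F ω) (F₁ ω) (F₂ ω)) :
    IsProfile C c d (fun x => ∫ ω, F ω x ∂P) (fun x => ∫ ω, F₁ ω x ∂P)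
      (fun x => ∫ ω, F₂ ω x ∂P) := by
  have hF₁ := aemeasurable_of_hasDerivAt (G' := F₁) hF
    fun x hx => h.mono fun ω hω => hω.hasDerivAt hx
  have hF₂ := aemeasurable_of_hasDerivAt (G' := F₂) hF₁
    fun x hx => h.mono fun ω hω => hω.hasDerivAt_one hx
  have hint : ∀ x ∈ Ioo 0 Real.pi, Integrable (fun ω => F ω x) P ∧
      Integrable (fun ω => F₁ ω x) P ∧ Integrable (fun ω => F₂ ω x) P := by
    intro x hx
    obtain ⟨α, β, hα, hβ, hxm, -⟩ := exists_Ioo_mem hx hx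
    refine ⟨.of_bound (hF x hx).aestronglyMeasurable (C α β) ?_,
      .of_bound (hF₁ x hx).aestronglyMeasurable (C α β) ?_,
      .of_bound (hF₂ x hx).aestronglyMeasurable (C α β) ?_⟩
    · exact h.mono fun ω hω => (hω.jet α β hα hβ).abs_zero x hxm
    · exact h.mono fun ω hω => (hω.jet α β hα hβ).abs_one x hxm
    · exact h.mono fun ω hω => (hω.jet α β hα hβ).abs_two x hxm
  have hbd : ∀ {K : ℝ} {g : Ω → ℝ}, (∀ᵐ ω ∂P, |g ω| ≤ K) → |∫ ω, g ω ∂P| ≤ K := by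
    intro K g hg
    have := norm_integral_le_of_norm_le_const (μ := P) (f := g) (C := K) hg
    simpa using this
  have hpi := Real.pi_pos
  have hmid : Real.pi / 2 ∈ Ioo 0 Real.pi := ⟨by linarith, by linarith⟩
  refine ⟨fun α β hα hβ => ?_, fun θ hθ => ?_, ?_, ?_⟩
  · have hm : ∀ {x}, x ∈ Ioo α β → x ∈ Ioo 0 Real.pi := fun hx => ⟨hα.trans hx.1, hx.2.trans hβ⟩
    refine ⟨fun x hx => hbd ?_, fun x hx => hbd ?_, fun x hx => hbd ?_, fun x hx y hy => ?_,
      fun x hx y hy => ?_, fun x hx y hy => ?_⟩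
    · exact h.mono fun ω hω => (hω.jet α β hα hβ).abs_zero x hx
    · exact h.mono fun ω hω => (hω.jet α β hα hβ).abs_one x hx
    · exact h.mono fun ω hω => (hω.jet α β hα hβ).abs_two x hx
    · have e : ∫ ω, (F ω y - F ω x - F₁ ω x * (y - x)) ∂P
          = ∫ ω, F ω y ∂P - ∫ ω, F ω x ∂P - (∫ ω, F₁ ω x ∂P) * (y - x) := by
        rw [integral_sub (f := fun ω => F ω y - F ω x)
          ((hint y (hm hy)).1.sub (hint x (hm hx)).1) ((hint x (hm hx)).2.1.mul_const _),
          integral_sub (hint y (hm hy)).1 (hint x (hm hx)).1, integral_mul_const]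
      rw [← e]
      exact hbd (h.mono fun ω hω => (hω.jet α β hα hβ).taylor_zero x hx y hy)
    · have e : ∫ ω, (F₁ ω y - F₁ ω x - F₂ ω x * (y - x)) ∂P
          = ∫ ω, F₁ ω y ∂P - ∫ ω, F₁ ω x ∂P - (∫ ω, F₂ ω x ∂P) * (y - x) := by
        rw [integral_sub (f := fun ω => F₁ ω y - F₁ ω x)
          ((hint y (hm hy)).2.1.sub (hint x (hm hx)).2.1) ((hint x (hm hx)).2.2.mul_const _),
          integral_sub (hint y (hm hy)).2.1 (hint x (hm hx)).2.1, integral_mul_const]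
      rw [← e]
      exact hbd (h.mono fun ω hω => (hω.jet α β hα hβ).taylor_one x hx y hy)
    · rw [← integral_sub (hint y (hm hy)).2.2 (hint x (hm hx)).2.2]
      exact hbd (h.mono fun ω hω => (hω.jet α β hα hβ).lip_two x hx y hy)
  · have := integral_mono_ae (integrable_const (c θ))
      (hint θ ⟨hθ.1, by linarith [hθ.2]⟩).2.1 (h.mono fun ω hω => hω.pos θ hθ)
    simpa using this
  · exact integral_eq_zero_of_ae (h.mono fun ω hω => hω.crit)
  · have := integral_mono_ae (hint _ hmid).2.2 (integrable_const (-d))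
      (h.mono fun ω hω => hω.neg)
    simpa using this

/-- A pointwise limit of profiles with common constants is a profile. The derivatives of the limit
are limits of the derivatives along an ultrafilter, which exist by boundedness. -/
lemma IsProfile.exists_of_tendsto {F F₁ F₂ : ℕ → ℝ → ℝ}
    (h : ∀ᶠ n in atTop, IsProfile C c d (F n) (F₁ n) (F₂ n))
    (hlim : ∀ x ∈ Ioo 0 Real.pi, Tendsto (fun n => F n x) atTop (𝓝 (f x))) :
    ∃ f₁ f₂, IsProfile C c d f f₁ f₂ := by
  set U : Ultrafilter ℕ := hyperfilter ℕ
  have hU : (U : Filter ℕ) ≤ atTop := Nat.hyperfilter_le_atTop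
  have hex : ∀ {g : ℕ → ℝ} {K : ℝ}, (∀ᶠ n in atTop, |g n| ≤ K) → ∃ l, Tendsto g U (𝓝 l) := by
    intro g K hg
    obtain ⟨l, -, hl⟩ := (isCompact_Icc (a := -K) (b := K)).ultrafilter_le_nhds (U.map g) (by
      rw [le_principal_iff]
      exact (hg.filter_mono hU).mono fun n hn => abs_le.1 hn)
    exact ⟨l, hl⟩
  have hex₁ : ∀ x, ∃ l, x ∈ Ioo 0 Real.pi → Tendsto (fun n => F₁ n x) U (𝓝 l) := by
    intro x
    by_cases hx : x ∈ Ioo 0 Real.pi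
    · obtain ⟨α, β, hα, hβ, hxm, -⟩ := exists_Ioo_mem hx hx
      obtain ⟨l, hl⟩ := hex (h.mono fun n hn => (hn.jet α β hα hβ).abs_one x hxm)
      exact ⟨l, fun _ => hl⟩
    · exact ⟨0, fun h => absurd h hx⟩
  have hex₂ : ∀ x, ∃ l, x ∈ Ioo 0 Real.pi → Tendsto (fun n => F₂ n x) U (𝓝 l) := by
    intro x
    by_cases hx : x ∈ Ioo 0 Real.pi
    · obtain ⟨α, β, hα, hβ, hxm, -⟩ := exists_Ioo_mem hx hx
      obtain ⟨l, hl⟩ := hex (h.mono fun n hn => (hn.jet α β hα hβ).abs_two x hxm)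
      exact ⟨l, fun _ => hl⟩
    · exact ⟨0, fun h => absurd h hx⟩
  choose f₁ hf₁ using hex₁
  choose f₂ hf₂ using hex₂
  have hf : ∀ x ∈ Ioo 0 Real.pi, Tendsto (fun n => F n x) U (𝓝 (f x)) :=
    fun x hx => (hlim x hx).mono_left hU
  have hh := h.filter_mono hU
  have hpi := Real.pi_pos
  have hmid : Real.pi / 2 ∈ Ioo 0 Real.pi := ⟨by linarith, by linarith⟩
  refine ⟨f₁, f₂, fun α β hα hβ => ?_, fun θ hθ => ?_, ?_, ?_⟩
  · have hm : ∀ {x}, x ∈ Ioo α β → x ∈ Ioo 0 Real.pi := fun hx => ⟨hα.trans hx.1, hx.2.trans hβ⟩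
    have hj := hh.mono fun n hn => hn.jet α β hα hβ
    refine ⟨fun x hx => ?_, fun x hx => ?_, fun x hx => ?_, fun x hx y hy => ?_,
      fun x hx y hy => ?_, fun x hx y hy => ?_⟩
    · exact le_of_tendsto (hf x (hm hx)).abs (hj.mono fun n hn => hn.abs_zero x hx)
    · exact le_of_tendsto (hf₁ x (hm hx)).abs (hj.mono fun n hn => hn.abs_one x hx)
    · exact le_of_tendsto (hf₂ x (hm hx)).abs (hj.mono fun n hn => hn.abs_two x hx)
    · exact le_of_tendsto (((hf y (hm hy)).sub (hf x (hm hx))).sub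
        ((hf₁ x (hm hx)).mul_const _)).abs (hj.mono fun n hn => hn.taylor_zero x hx y hy)
    · exact le_of_tendsto (((hf₁ y (hm hy)).sub (hf₁ x (hm hx))).sub
        ((hf₂ x (hm hx)).mul_const _)).abs (hj.mono fun n hn => hn.taylor_one x hx y hy)
    · exact le_of_tendsto ((hf₂ y (hm hy)).sub (hf₂ x (hm hx))).abs
        (hj.mono fun n hn => hn.lip_two x hx y hy)
  · exact ge_of_tendsto (hf₁ θ ⟨hθ.1, by linarith [hθ.2]⟩) (hh.mono fun n hn => hn.pos θ hθ)
  · exact tendsto_nhds_unique (hf₁ _ hmid)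
      (tendsto_const_nhds.congr' (hh.mono fun n hn => hn.crit.symm))
  · exact le_of_tendsto (hf₂ _ hmid) (hh.mono fun n hn => hn.neg)

end Profile

/-! ### The factors `|z(θ)² + t|²` along the ellipse -/

lemma ellipse_re (a b θ : ℝ) : (ellipse a b θ).re = (a + b) * Real.sin θ := by
  have h : ellipse a b θ = Complex.I * a * Complex.exp ((-θ : ℝ) * Complex.I)
      - Complex.I * b * Complex.exp (θ * Complex.I) := by
    rw [ellipse]; push_cast; ring_nf
  rw [h, Complex.exp_mul_I, Complex.exp_mul_I]
  simp [← Complex.ofReal_cos, ← Complex.ofReal_sin]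
  ring

lemma ellipse_im (a b θ : ℝ) : (ellipse a b θ).im = (a - b) * Real.cos θ := by
  have h : ellipse a b θ = Complex.I * a * Complex.exp ((-θ : ℝ) * Complex.I)
      - Complex.I * b * Complex.exp (θ * Complex.I) := by
    rw [ellipse]; push_cast; ring_nf
  rw [h, Complex.exp_mul_I, Complex.exp_mul_I]
  simp [← Complex.ofReal_cos, ← Complex.ofReal_sin]
  ring

/-- The squared modulus of `z(θ)`. -/
noncomputable def ellipseNormSq (a b θ : ℝ) : ℝ := (a - b) ^ 2 + 4 * a * b * Real.sin θ ^ 2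

/-- The squared modulus of `z(θ)² + t`, for real `t`. -/
noncomputable def factor (a b t θ : ℝ) : ℝ :=
  (ellipseNormSq a b θ - t) ^ 2 + 4 * (a + b) ^ 2 * t * Real.sin θ ^ 2

/-- A positive quantity such that `∂θ factor = 8 sin θ cos θ * factorAux`. -/
noncomputable def factorAux (a b t θ : ℝ) : ℝ :=
  2 * a * b * ellipseNormSq a b θ + t * (a ^ 2 + b ^ 2)

/-- The first derivative of `factor` in `θ`. -/
noncomputable def factor₁ (a b t θ : ℝ) : ℝ := 8 * (Real.sin θ * Real.cos θ) * factorAux a b t θ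

/-- The second derivative of `factor` in `θ`. -/
noncomputable def factor₂ (a b t θ : ℝ) : ℝ :=
  8 * (Real.cos θ * Real.cos θ - Real.sin θ * Real.sin θ) * factorAux a b t θ
    + 128 * a ^ 2 * b ^ 2 * (Real.sin θ * Real.cos θ) ^ 2

/-- The third derivative of `factor` in `θ`. -/
noncomputable def factor₃ (a b t θ : ℝ) : ℝ :=
  -(32 * (Real.sin θ * Real.cos θ) * factorAux a b t θ)
    + 384 * a ^ 2 * b ^ 2 * (Real.sin θ * Real.cos θ)
      * (Real.cos θ * Real.cos θ - Real.sin θ * Real.sin θ)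

lemma norm_ellipse_sq_add (a b t θ : ℝ) :
    ‖ellipse a b θ ^ 2 + (t : ℂ)‖ ^ 2 = factor a b t θ := by
  rw [← Complex.normSq_eq_norm_sq, Complex.normSq_apply, sq (ellipse a b θ)]
  simp only [Complex.add_re, Complex.add_im, Complex.mul_re, Complex.mul_im, Complex.ofReal_re,
    Complex.ofReal_im, ellipse_re, ellipse_im, factor, ellipseNormSq]
  have hc : Real.cos θ ^ 2 = 1 - Real.sin θ ^ 2 := Real.cos_sq' θ
  have hc4 : Real.cos θ ^ 4 = (1 - Real.sin θ ^ 2) ^ 2 := by rw [← hc]; ring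
  ring_nf
  rw [hc4, hc]
  ring

section Positive

variable {a b t θ : ℝ}

lemma ellipseNormSq_pos (ha : 0 < a) (hb : 0 < b) (hθ : θ ∈ Ioo 0 Real.pi) :
    0 < ellipseNormSq a b θ := by
  have := Real.sin_pos_of_mem_Ioo hθ
  rw [ellipseNormSq]; positivity

lemma factor_pos (ha : 0 < a) (hb : 0 < b) (ht : 0 ≤ t) (hθ : θ ∈ Ioo 0 Real.pi) :
    0 < factor a b t θ := by
  have hs := Real.sin_pos_of_mem_Ioo hθ
  have hY := ellipseNormSq_pos ha hb hθ
  rw [factor]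
  rcases ht.eq_or_lt with rfl | ht
  · rw [sub_zero]; positivity
  · positivity

lemma factorAux_pos (ha : 0 < a) (hb : 0 < b) (ht : 0 ≤ t) (hθ : θ ∈ Ioo 0 Real.pi) :
    0 < factorAux a b t θ := by
  have hY := ellipseNormSq_pos ha hb hθ
  rw [factorAux]; positivity

/-- The modulus of `z(θ)² + t` is smallest at `θ = 0`. -/
lemma factor_zero_le (ha : 0 < a) (hb : 0 < b) (ht : 0 ≤ t) (θ : ℝ) :
    factor a b t 0 ≤ factor a b t θ := by
  simp only [factor, ellipseNormSq, Real.sin_zero]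
  have h : 0 ≤ (4 * a * b * Real.sin θ ^ 2) ^ 2
      + 8 * a * b * (a - b) ^ 2 * Real.sin θ ^ 2 + 4 * (a ^ 2 + b ^ 2) * t * Real.sin θ ^ 2 := by
    positivity
  linarith

end Positive

lemma hasDerivAt_sin_mul_cos (θ : ℝ) : HasDerivAt (fun θ => Real.sin θ * Real.cos θ)
    (Real.cos θ * Real.cos θ - Real.sin θ * Real.sin θ) θ := by
  refine ((Real.hasDerivAt_sin θ).fun_mul (Real.hasDerivAt_cos θ)).congr_deriv ?_
  ring

lemma hasDerivAt_cos_sq_sub_sin_sq (θ : ℝ) :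
    HasDerivAt (fun θ => Real.cos θ * Real.cos θ - Real.sin θ * Real.sin θ)
      (-(4 * (Real.sin θ * Real.cos θ))) θ := by
  refine (((Real.hasDerivAt_cos θ).fun_mul (Real.hasDerivAt_cos θ)).fun_sub
    ((Real.hasDerivAt_sin θ).fun_mul (Real.hasDerivAt_sin θ))).congr_deriv ?_
  ring

lemma hasDerivAt_ellipseNormSq (a b θ : ℝ) :
    HasDerivAt (ellipseNormSq a b) (8 * a * b * (Real.sin θ * Real.cos θ)) θ := by
  refine ((((Real.hasDerivAt_sin θ).fun_pow 2).const_mul (4 * a * b)).const_add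
    ((a - b) ^ 2)).congr_deriv ?_
  simp; ring

lemma hasDerivAt_factorAux (a b t θ : ℝ) :
    HasDerivAt (factorAux a b t) (16 * a ^ 2 * b ^ 2 * (Real.sin θ * Real.cos θ)) θ := by
  refine (((hasDerivAt_ellipseNormSq a b θ).const_mul (2 * a * b)).add_const
    (t * (a ^ 2 + b ^ 2))).congr_deriv ?_
  ring

lemma hasDerivAt_factor (a b t θ : ℝ) : HasDerivAt (factor a b t) (factor₁ a b t θ) θ := by
  refine ((((hasDerivAt_ellipseNormSq a b θ).sub_const t).fun_pow 2).fun_add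
    (((Real.hasDerivAt_sin θ).fun_pow 2).const_mul (4 * (a + b) ^ 2 * t))).congr_deriv ?_
  simp only [factor₁, factorAux, ellipseNormSq]
  simp; ring

lemma hasDerivAt_factor₁ (a b t θ : ℝ) : HasDerivAt (factor₁ a b t) (factor₂ a b t θ) θ := by
  refine (((hasDerivAt_sin_mul_cos θ).const_mul 8).fun_mul
    (hasDerivAt_factorAux a b t θ)).congr_deriv ?_
  simp only [factor₂]
  ring

lemma hasDerivAt_factor₂ (a b t θ : ℝ) : HasDerivAt (factor₂ a b t) (factor₃ a b t θ) θ := by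
  refine ((((hasDerivAt_cos_sq_sub_sin_sq θ).const_mul 8).fun_mul
    (hasDerivAt_factorAux a b t θ)).fun_add
    (((hasDerivAt_sin_mul_cos θ).fun_pow 2).const_mul (128 * a ^ 2 * b ^ 2))).congr_deriv ?_
  simp only [factor₃]
  simp; ring

/-- The first derivative of `log factor` in `θ`. -/
noncomputable def logFactor₁ (a b t θ : ℝ) : ℝ := factor₁ a b t θ / factor a b t θ

/-- The second derivative of `log factor` in `θ`. -/
noncomputable def logFactor₂ (a b t θ : ℝ) : ℝ :=
  (factor₂ a b t θ * factor a b t θ - factor₁ a b t θ * factor₁ a b t θ) / factor a b t θ ^ 2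

/-- The third derivative of `log factor` in `θ`. -/
noncomputable def logFactor₃ (a b t θ : ℝ) : ℝ :=
  ((factor₃ a b t θ * factor a b t θ - factor₁ a b t θ * factor₂ a b t θ) * factor a b t θ
    - 2 * factor₁ a b t θ
      * (factor₂ a b t θ * factor a b t θ - factor₁ a b t θ * factor₁ a b t θ))
    / factor a b t θ ^ 3

lemma hasDerivAt_log_factor {a b t θ : ℝ} (h : factor a b t θ ≠ 0) :
    HasDerivAt (fun θ => Real.log (factor a b t θ)) (logFactor₁ a b t θ) θ :=
  (hasDerivAt_factor a b t θ).log h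

lemma hasDerivAt_logFactor₁ {a b t θ : ℝ} (h : factor a b t θ ≠ 0) :
    HasDerivAt (logFactor₁ a b t) (logFactor₂ a b t θ) θ :=
  (hasDerivAt_factor₁ a b t θ).fun_div (hasDerivAt_factor a b t θ) h

lemma hasDerivAt_logFactor₂ {a b t θ : ℝ} (h : factor a b t θ ≠ 0) :
    HasDerivAt (logFactor₂ a b t) (logFactor₃ a b t θ) θ := by
  refine ((((hasDerivAt_factor₂ a b t θ).fun_mul (hasDerivAt_factor a b t θ)).fun_sub
    ((hasDerivAt_factor₁ a b t θ).fun_mul (hasDerivAt_factor₁ a b t θ))).fun_div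
    ((hasDerivAt_factor a b t θ).fun_pow 2) (pow_ne_zero 2 h)).congr_deriv ?_
  simp only [logFactor₃]
  field_simp
  ring

lemma continuous_ellipseNormSq (a b : ℝ) : Continuous (ellipseNormSq a b) := by
  unfold ellipseNormSq; fun_prop

lemma continuous_factorAux (a b : ℝ) : Continuous fun p : ℝ × ℝ => factorAux a b p.1 p.2 := by
  have := continuous_ellipseNormSq a b
  unfold factorAux; fun_prop

lemma continuous_factor (a b : ℝ) : Continuous fun p : ℝ × ℝ => factor a b p.1 p.2 := by
  have := continuous_ellipseNormSq a b
  unfold factor; fun_prop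

lemma continuous_factor₁ (a b : ℝ) : Continuous fun p : ℝ × ℝ => factor₁ a b p.1 p.2 := by
  have := continuous_factorAux a b
  unfold factor₁; fun_prop

lemma continuous_factor₂ (a b : ℝ) : Continuous fun p : ℝ × ℝ => factor₂ a b p.1 p.2 := by
  have := continuous_factorAux a b
  unfold factor₂; fun_prop

lemma continuous_factor₃ (a b : ℝ) : Continuous fun p : ℝ × ℝ => factor₃ a b p.1 p.2 := by
  have := continuous_factorAux a b
  unfold factor₃; fun_prop

section ContinuousOn

variable {a b : ℝ} {S : Set (ℝ × ℝ)}

lemma continuousOn_logFactor₁ (h : ∀ p ∈ S, factor a b p.1 p.2 ≠ 0) :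
    ContinuousOn (fun p : ℝ × ℝ => logFactor₁ a b p.1 p.2) S := by
  have h0 := (continuous_factor a b).continuousOn (s := S)
  have h1 := (continuous_factor₁ a b).continuousOn (s := S)
  unfold logFactor₁
  exact h1.div h0 h

lemma continuousOn_logFactor₂ (h : ∀ p ∈ S, factor a b p.1 p.2 ≠ 0) :
    ContinuousOn (fun p : ℝ × ℝ => logFactor₂ a b p.1 p.2) S := by
  have h0 := (continuous_factor a b).continuousOn (s := S)
  have h1 := (continuous_factor₁ a b).continuousOn (s := S)
  have h2 := (continuous_factor₂ a b).continuousOn (s := S)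
  unfold logFactor₂
  refine ContinuousOn.div ?_ (h0.pow 2) fun p hp => pow_ne_zero 2 (h p hp)
  fun_prop

lemma continuousOn_logFactor₃ (h : ∀ p ∈ S, factor a b p.1 p.2 ≠ 0) :
    ContinuousOn (fun p : ℝ × ℝ => logFactor₃ a b p.1 p.2) S := by
  have h0 := (continuous_factor a b).continuousOn (s := S)
  have h1 := (continuous_factor₁ a b).continuousOn (s := S)
  have h2 := (continuous_factor₂ a b).continuousOn (s := S)
  have h3 := (continuous_factor₃ a b).continuousOn (s := S)
  unfold logFactor₃
  refine ContinuousOn.div ?_ (h0.pow 3) fun p hp => pow_ne_zero 3 (h p hp)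
  fun_prop

end ContinuousOn

lemma exists_jetBound_log_factor {a b : ℝ} (ha : 0 < a) (hb : 0 < b) (T : ℝ) {α β : ℝ}
    (hα : 0 < α) (hβ : β < Real.pi) : ∃ K : ℝ, ∀ t ∈ Icc 0 T, JetBound K (Ioo α β)
      (fun θ => Real.log (factor a b t θ)) (logFactor₁ a b t) (logFactor₂ a b t) := by
  have hcomp : IsCompact (Icc 0 T ×ˢ Icc α β) := isCompact_Icc.prod isCompact_Icc
  have hne : ∀ p ∈ Icc 0 T ×ˢ Icc α β, factor a b p.1 p.2 ≠ 0 := fun p hp =>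
    (factor_pos ha hb hp.1.1 ⟨hα.trans_le hp.2.1, hp.2.2.trans_lt hβ⟩).ne'
  obtain ⟨K₀, hK₀⟩ := hcomp.exists_bound_of_continuousOn
    ((continuous_factor a b).continuousOn.log hne)
  obtain ⟨K₁, hK₁⟩ := hcomp.exists_bound_of_continuousOn (continuousOn_logFactor₁ hne)
  obtain ⟨K₂, hK₂⟩ := hcomp.exists_bound_of_continuousOn (continuousOn_logFactor₂ hne)
  obtain ⟨K₃, hK₃⟩ := hcomp.exists_bound_of_continuousOn (continuousOn_logFactor₃ hne)
  refine ⟨max (max K₀ K₁) (max K₂ K₃), fun t ht => ?_⟩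
  have hmem : ∀ x ∈ Ioo α β, (t, x) ∈ Icc 0 T ×ˢ Icc α β := fun x hx =>
    ⟨ht, hx.1.le, hx.2.le⟩
  have hne' : ∀ x ∈ Ioo α β, factor a b t x ≠ 0 := fun x hx => hne (t, x) (hmem x hx)
  refine jetBound_of_hasDerivAt (f₃ := logFactor₃ a b t) (convex_Ioo α β) (fun x hx => ?_)
    (fun x hx => ?_) (fun x hx => ?_) (fun x hx => ?_) (fun x hx => ?_) (fun x hx => ?_)
    (fun x hx => ?_)
  · exact hasDerivAt_log_factor (hne' x hx)
  · exact hasDerivAt_logFactor₁ (hne' x hx)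
  · exact hasDerivAt_logFactor₂ (hne' x hx)
  · exact (hK₀ (t, x) (hmem x hx)).trans ((le_max_left _ _).trans (le_max_left _ _))
  · exact (hK₁ (t, x) (hmem x hx)).trans ((le_max_right _ _).trans (le_max_left _ _))
  · exact (hK₂ (t, x) (hmem x hx)).trans ((le_max_left _ _).trans (le_max_right _ _))
  · exact (hK₃ (t, x) (hmem x hx)).trans ((le_max_right _ _).trans (le_max_right _ _))

/-- The functions `θ ↦ log |z(θ)² + t|²` are profiles, uniformly for `t` in a compact interval. -/
lemma exists_isProfile_log_factor {a b : ℝ} (ha : 0 < a) (hb : 0 < b) {T : ℝ} (hT : 0 ≤ T) :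
    ∃ (C : ℝ → ℝ → ℝ) (c : ℝ → ℝ) (d : ℝ), (∀ θ ∈ Ioo 0 (Real.pi / 2), 0 < c θ) ∧ 0 < d ∧
      ∀ t ∈ Icc 0 T, IsProfile C c d (fun θ => Real.log (factor a b t θ)) (logFactor₁ a b t)
        (logFactor₂ a b t) := by
  have hC : ∀ α β : ℝ, ∃ K : ℝ, 0 < α → β < Real.pi → ∀ t ∈ Icc 0 T, JetBound K (Ioo α β)
      (fun θ => Real.log (factor a b t θ)) (logFactor₁ a b t) (logFactor₂ a b t) := by
    intro α β
    by_cases hαβ : 0 < α ∧ β < Real.pi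
    · obtain ⟨K, hK⟩ := exists_jetBound_log_factor ha hb T hαβ.1 hαβ.2
      exact ⟨K, fun _ _ => hK⟩
    · exact ⟨0, fun h1 h2 => absurd ⟨h1, h2⟩ hαβ⟩
  have hcA : ∀ θ, Continuous fun t => factorAux a b t θ := fun θ => by
    unfold factorAux; fun_prop
  have hc0 : ∀ θ, Continuous fun t => factor a b t θ := fun θ => by unfold factor; fun_prop
  have hpi := Real.pi_pos
  have hmid : Real.pi / 2 ∈ Ioo 0 Real.pi := ⟨by linarith, by linarith⟩
  -- A continuous positive function of `t` has a positive lower bound on `[0, T]`.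
  have hmin : ∀ g : ℝ → ℝ, ContinuousOn g (Icc 0 T) → (∀ t ∈ Icc 0 T, 0 < g t) →
      ∃ k, 0 < k ∧ ∀ t ∈ Icc 0 T, k ≤ g t := by
    intro g hg hpos
    obtain ⟨t₀, ht₀, hm⟩ := isCompact_Icc.exists_isMinOn (nonempty_Icc.2 hT) hg
    exact ⟨g t₀, hpos t₀ ht₀, fun t ht => hm ht⟩
  have hc : ∀ θ : ℝ, ∃ k : ℝ, θ ∈ Ioo 0 (Real.pi / 2) →
      0 < k ∧ ∀ t ∈ Icc 0 T, k ≤ logFactor₁ a b t θ := by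
    intro θ
    by_cases hθ : θ ∈ Ioo 0 (Real.pi / 2)
    swap
    · exact ⟨0, fun h => absurd h hθ⟩
    have hθ' : θ ∈ Ioo 0 Real.pi := ⟨hθ.1, by linarith [hθ.2]⟩
    have hcont : ContinuousOn (fun t => logFactor₁ a b t θ) (Icc 0 T) := by
      unfold logFactor₁ factor₁
      have h0 := hc0 θ
      have hA := hcA θ
      refine ContinuousOn.div (by fun_prop) (by fun_prop) fun t ht => ?_
      exact (factor_pos ha hb ht.1 hθ').ne'
    obtain ⟨k, hk⟩ := hmin _ hcont fun t ht => by
      have h1 := factor_pos ha hb ht.1 hθ'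
      have h2 := factorAux_pos ha hb ht.1 hθ'
      have h3 := Real.sin_pos_of_mem_Ioo hθ'
      have h4 := Real.cos_pos_of_mem_Ioo ⟨by linarith [hθ.1], hθ.2⟩
      simp only [logFactor₁, factor₁]
      positivity
    exact ⟨k, fun _ => hk⟩
  have hcont : ContinuousOn
      (fun t => 8 * factorAux a b t (Real.pi / 2) / factor a b t (Real.pi / 2)) (Icc 0 T) := by
    have h0 := hc0 (Real.pi / 2)
    have hA := hcA (Real.pi / 2)
    refine ContinuousOn.div (by fun_prop) (by fun_prop) fun t ht => ?_
    exact (factor_pos ha hb ht.1 hmid).ne'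
  obtain ⟨d, hd0, hd⟩ := hmin _ hcont fun t ht => by
    have h1 := factor_pos ha hb ht.1 hmid
    have h2 := factorAux_pos ha hb ht.1 hmid
    positivity
  choose C hC using hC
  choose c hc using hc
  refine ⟨C, c, d, fun θ hθ => (hc θ hθ).1, hd0, fun t ht => ⟨fun α β hα hβ => hC α β hα hβ t ht,
    fun θ hθ => (hc θ hθ).2 t ht, ?_, ?_⟩⟩
  · simp [logFactor₁, factor₁]
  · refine le_trans (le_of_eq ?_) (neg_le_neg (hd t ht))
    have h0 := (factor_pos ha hb ht.1 hmid).ne'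
    simp only [logFactor₂, factor₁, factor₂, Real.cos_pi_div_two, Real.sin_pi_div_two]
    field_simp
    ring

/-! ### The Lyapunov exponent along the ellipse -/

lemma log_multiset_map_prod {ι : Type*} (s : Multiset ι) (f : ι → ℝ) (h : ∀ i ∈ s, f i ≠ 0) :
    Real.log (s.map f).prod = (s.map fun i => Real.log (f i)).sum := by
  rw [Real.log_multiset_prod (by simpa using h), Multiset.map_map]
  rfl

lemma norm_ellipse_sq_add_eq (a b t θ : ℝ) :
    ‖ellipse a b θ ^ 2 + (t : ℂ)‖ = √(factor a b t θ) := by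
  rw [← norm_ellipse_sq_add, Real.sqrt_sq (norm_nonneg _)]

section Continuant

variable {a b m M : ℝ} {v : ℕ → ℝ × ℝ}

lemma log_norm_continuant (ha : 0 < a) (hb : 0 < b) (hm : 0 < m) (hv : IsBoxed m M v) (n : ℕ)
    {θ : ℝ} (hθ : θ ∈ Ioo 0 Real.pi) :
    Real.log ‖(continuant v n).eval (ellipse a b θ)‖ = Real.log (∏ i ∈ Finset.range n, (v i).1)
      + 1 / 4 * ((continuant v n).roots.map
          fun r => Real.log (factor a b (r.im ^ 2) θ)).sum := by
  have hlead : 0 < ∏ i ∈ Finset.range n, (v i).1 :=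
    Finset.prod_pos fun i _ => hm.trans_le (hv i).1.1
  have hfac : ∀ r : ℂ, 0 < factor a b (r.im ^ 2) θ := fun r =>
    factor_pos ha hb (sq_nonneg _) hθ
  have h := congrArg Real.log (norm_continuant_sq m M hm v hv n (ellipse a b θ))
  have hne : ∀ r ∈ (continuant v n).roots,
      ‖ellipse a b θ ^ 2 + ((r.im ^ 2 : ℝ) : ℂ)‖ ≠ 0 := fun r _ => by
    rw [norm_ellipse_sq_add_eq]; exact (Real.sqrt_pos.2 (hfac r)).ne'
  rw [Real.log_pow, Real.log_mul (by positivity) (by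
      simp only [ne_eq, Multiset.prod_eq_zero_iff, Multiset.mem_map, not_exists, not_and]
      exact hne), Real.log_pow, log_multiset_map_prod _ _ hne] at h
  have hs : ((continuant v n).roots.map
      fun r => Real.log ‖ellipse a b θ ^ 2 + ((r.im ^ 2 : ℝ) : ℂ)‖).sum
      = 1 / 2 * ((continuant v n).roots.map
          fun r => Real.log (factor a b (r.im ^ 2) θ)).sum := by
    rw [← Multiset.sum_map_mul_left]
    refine congrArg Multiset.sum (Multiset.map_congr rfl fun r _ => ?_)
    rw [norm_ellipse_sq_add_eq, Real.log_sqrt (hfac r).le]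
    ring
  rw [hs] at h
  push_cast at h
  linarith

/-- The modulus of a continuant on the ellipse is smallest at `θ = 0`. -/
lemma norm_continuant_ellipse_zero_le (ha : 0 < a) (hb : 0 < b) (hm : 0 < m) (hv : IsBoxed m M v)
    (n : ℕ) (θ : ℝ) : ‖(continuant v n).eval (ellipse a b 0)‖
      ≤ ‖(continuant v n).eval (ellipse a b θ)‖ := by
  refine (sq_le_sq₀ (norm_nonneg _) (norm_nonneg _)).1 ?_
  rw [norm_continuant_sq m M hm v hv, norm_continuant_sq m M hm v hv]
  refine mul_le_mul_of_nonneg_left ?_ (sq_nonneg _)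
  refine Multiset.prod_map_le_prod_map₀ _ _ (fun r _ => norm_nonneg _) fun r _ => ?_
  rw [norm_ellipse_sq_add_eq, norm_ellipse_sq_add_eq]
  exact Real.sqrt_le_sqrt (factor_zero_le ha hb (sq_nonneg _) θ)

lemma matNorm_ellipse_zero_le (ha : 0 < a) (hb : 0 < b) (hm : 0 < m) (hv : IsBoxed m M v)
    (n : ℕ) (θ : ℝ) : matNorm (transferProd v (ellipse a b 0) (n + 2))
      ≤ matNorm (transferProd v (ellipse a b θ) (n + 2)) := by
  rw [transferProd_add_two, transferProd_add_two, matNorm_fin_two, matNorm_fin_two]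
  simp only [norm_mul]
  have h := fun k => norm_continuant_ellipse_zero_le ha hb hm hv k θ
  have h' := fun k => norm_continuant_ellipse_zero_le ha hb hm (hv.shift 1) k θ
  exact add_le_add (add_le_add (h _) (mul_le_mul_of_nonneg_left (h _) (norm_nonneg _)))
    (add_le_add (h' _) (mul_le_mul_of_nonneg_left (h' _) (norm_nonneg _)))

/-- In the right half plane the norm of the product of transfer matrices is comparable with its
upper left entry. -/
lemma matNorm_le_mul_norm_continuant (hm : 0 < m) {z : ℂ} (hz : 0 < z.re) :
    ∃ K : ℝ, 0 < K ∧ ∀ v : ℕ → ℝ × ℝ, IsBoxed m M v → ∀ n : ℕ,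
      matNorm (transferProd v z (n + 2)) ≤ K * ‖(continuant v (n + 2)).eval z‖ := by
  set ρ : ℝ := (z.re * m)⁻¹
  have hρ : 0 < ρ := by positivity
  refine ⟨1 + M ^ 2 * ρ + (ρ + M ^ 2 * (ρ * ρ)), by positivity, fun v hv n => ?_⟩
  have key : ∀ {p q : ℝ}, z.re * m * p ≤ q → p ≤ ρ * q := fun h => by
    rwa [← div_eq_inv_mul, le_div_iff₀' (by positivity)]
  have h1 := key (mul_norm_continuant_le m M hm v hv z hz.le (n + 1))
  have h2 := key (mul_norm_continuant_shift_le m M hm v hv z hz.le (n + 1))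
  have h3 := key (mul_norm_continuant_le m M hm _ (hv.shift 1) z hz.le n)
  have hy : ‖((v (n + 1)).2 : ℂ) ^ 2‖ ≤ M ^ 2 := by
    rw [norm_pow, Complex.norm_real, Real.norm_eq_abs, abs_of_pos (hm.trans_le (hv _).2.1)]
    exact pow_le_pow_left₀ (hm.le.trans (hv _).2.1) (hv _).2.2 2
  rw [transferProd_add_two, matNorm_fin_two, norm_mul, norm_mul, add_mul, add_mul, add_mul, one_mul]
  refine add_le_add (add_le_add le_rfl ?_) (add_le_add h2 ?_)
  · rw [mul_assoc]
    exact mul_le_mul hy h1 (norm_nonneg _) (sq_nonneg _)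
  · rw [mul_assoc, mul_assoc]
    exact mul_le_mul hy (h3.trans (mul_le_mul_of_nonneg_left h2 hρ.le)) (norm_nonneg _)
      (sq_nonneg _)

lemma norm_continuant_le_matNorm (v : ℕ → ℝ × ℝ) (z : ℂ) (n : ℕ) :
    ‖(continuant v (n + 2)).eval z‖ ≤ matNorm (transferProd v z (n + 2)) := by
  rw [transferProd_add_two, matNorm_fin_two, add_assoc]
  exact le_add_of_nonneg_right (by positivity)

lemma abs_log_prod_le (hm : 0 < m) (hv : IsBoxed m M v) {n : ℕ} :
    |Real.log (∏ i ∈ Finset.range n, (v i).1)| ≤ n * (|Real.log m| + |Real.log M|) := by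
  rw [Real.log_prod fun i _ => (hm.trans_le (hv i).1.1).ne']
  refine (Finset.abs_sum_le_sum_abs _ _).trans ?_
  have h : ∀ i ∈ Finset.range n, |Real.log (v i).1| ≤ |Real.log m| + |Real.log M| := fun i _ => by
    have h1 := Real.log_le_log hm (hv i).1.1
    have h2 := Real.log_le_log (hm.trans_le (hv i).1.1) (hv i).1.2
    have h3 := neg_abs_le (Real.log m)
    have h4 := le_abs_self (Real.log M)
    exact abs_le.2 ⟨by linarith [abs_nonneg (Real.log M)], by linarith [abs_nonneg (Real.log m)]⟩
  simpa [mul_add] using Finset.sum_le_sum h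

/-- The functions `θ ↦ (1/n) log |K_n(z(θ))|` are profiles, uniformly in `n` and in the weights. -/
lemma exists_isProfile_continuant (ha : 0 < a) (hb : 0 < b) (hm : 0 < m) (M : ℝ) :
    ∃ (C : ℝ → ℝ → ℝ) (c : ℝ → ℝ) (d : ℝ), (∀ θ ∈ Ioo 0 (Real.pi / 2), 0 < c θ) ∧ 0 < d ∧
      ∀ v : ℕ → ℝ × ℝ, IsBoxed m M v → ∀ n : ℕ, 0 < n → IsProfile C c d
        (fun θ => 1 / n * Real.log ‖(continuant v n).eval (ellipse a b θ)‖)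
        (fun θ => 1 / n * (0 + 1 / 4 * ((continuant v n).roots.map
          fun r => logFactor₁ a b (r.im ^ 2) θ).sum))
        (fun θ => 1 / n * (0 + 1 / 4 * ((continuant v n).roots.map
          fun r => logFactor₂ a b (r.im ^ 2) θ).sum)) := by
  obtain ⟨C, c, d, hc, hd, h⟩ := exists_isProfile_log_factor ha hb (sq_nonneg (2 * M / m))
  refine ⟨fun α β => |Real.log m| + |Real.log M| + 1 / 4 * C α β, fun θ => 1 / 4 * c θ, 1 / 4 * d,
    fun θ hθ => mul_pos (by norm_num) (hc θ hθ), by positivity, fun v hv n hn => ?_⟩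
  have hn' : (0 : ℝ) < n := by exact_mod_cast hn
  have hcard : ((continuant v n).roots.card : ℝ) = n := by
    rw [IsAlgClosed.card_roots_eq_natDegree, (natDegree_continuant m M hm v hv n).1]
  have hsum := IsProfile.multiset_sum (continuant v n).roots
    (F := fun r θ => Real.log (factor a b (r.im ^ 2) θ)) fun r hr =>
      h (r.im ^ 2) (root_continuant m M hm v hv n r hr).2
  have htot := ((IsProfile.const (Real.log (∏ i ∈ Finset.range n, (v i).1))).add
    (hsum.const_mul (by norm_num : (0 : ℝ) ≤ 1 / 4))).const_mul
    (by positivity : (0 : ℝ) ≤ 1 / n)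
  rw [hcard] at htot
  refine (htot.mono (fun α β => ?_) (fun θ => ?_) ?_).of_congr fun θ hθ => ?_
  · rw [mul_add]
    refine add_le_add ?_ (le_of_eq ?_)
    · rw [one_div_mul_eq_div, div_le_iff₀' hn']
      exact abs_log_prod_le hm hv
    · field_simp
  · exact le_of_eq (by field_simp; ring)
  · exact le_of_eq (by field_simp; ring)
  · rw [log_norm_continuant ha hb hm hv n hθ]

end Continuant

lemma meanLogGrowth_eq {Ω : Type*} [MeasurableSpace Ω] {P : Measure Ω} {w₁ w₂ : ℕ → Ω → ℝ}
    (z : ℂ) (n : ℕ) :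
    meanLogGrowth P (fun y ω => transferMatrix z (w₁ y ω) (w₂ y ω)) n
      = 1 / n * ∫ ω, Real.log (matNorm (transferProd (weights w₁ w₂ ω) z n)) ∂P := rfl

section Disorder

variable {Ω : Type*} [MeasurableSpace Ω] {P : Measure Ω} [IsProbabilityMeasure P]
  {w₁ w₂ : ℕ → Ω → ℝ}

/-- In the right half plane the Lyapunov exponent is the growth rate of the continuants. -/
lemma IsDisorder.tendsto_integral_log_continuant (hw : IsDisorder P w₁ w₂) {z : ℂ}
    (hz : 0 < z.re) (hint : ∀ᶠ n : ℕ in atTop, Integrable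
      (fun ω => 1 / (n : ℝ) * Real.log ‖(continuant (weights w₁ w₂ ω) n).eval z‖) P) :
    Tendsto (fun n : ℕ => ∫ ω, 1 / (n : ℝ) *
      Real.log ‖(continuant (weights w₁ w₂ ω) n).eval z‖ ∂P) atTop (𝓝 (lyap P w₁ w₂ z)) := by
  obtain ⟨m, M, hm, hbox⟩ := hw.exists_isBoxed
  obtain ⟨K, hK, hKle⟩ := matNorm_le_mul_norm_continuant (M := M) hm hz
  have hL := hw.tendsto_meanLogGrowth z
  have h0 : Tendsto (fun n : ℕ => 1 / (n : ℝ) * Real.log K) atTop (𝓝 0) := by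
    simpa using tendsto_one_div_atTop_nhds_zero_nat.mul_const (Real.log K)
  have hL' := hL.sub h0
  rw [sub_zero] at hL'
  refine tendsto_of_tendsto_of_tendsto_of_le_of_le' hL' hL ?_ ?_
  · filter_upwards [hint, eventually_ge_atTop 2] with n hn h2
    obtain ⟨k, rfl⟩ := Nat.exists_eq_add_of_le' h2
    have hi := (hw.integrable_log_matNorm z (k + 2)).const_mul (1 / ((k + 2 : ℕ) : ℝ))
    have hi' := hi.sub (integrable_const (μ := P) (1 / ((k + 2 : ℕ) : ℝ) * Real.log K))
    rw [meanLogGrowth_eq, ← integral_const_mul]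
    have := integral_mono_ae hi' hn ?_
    · rwa [integral_sub' hi (integrable_const _), integral_const, probReal_univ, one_smul] at this
    · filter_upwards [hbox] with ω hω
      simp only [Pi.sub_apply]
      rw [← mul_sub]
      refine mul_le_mul_of_nonneg_left ?_ (by positivity)
      have hp := norm_pos_iff.2 (continuant_eval_ne_zero m M hm _ hω z hz (k + 2))
      have := Real.log_le_log (matNorm_transferProd_pos m M hm _ hω z (k + 2)) (hKle _ hω k)
      rw [Real.log_mul hK.ne' hp.ne'] at this
      linarith
  · filter_upwards [hint, eventually_ge_atTop 2] with n hn h2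
    obtain ⟨k, rfl⟩ := Nat.exists_eq_add_of_le' h2
    rw [meanLogGrowth_eq, ← integral_const_mul]
    refine integral_mono_ae hn
      ((hw.integrable_log_matNorm z (k + 2)).const_mul (1 / ((k + 2 : ℕ) : ℝ))) ?_
    filter_upwards [hbox] with ω hω
    refine mul_le_mul_of_nonneg_left ?_ (by positivity)
    exact Real.log_le_log
      (norm_pos_iff.2 (continuant_eval_ne_zero m M hm _ hω z hz (k + 2)))
      (norm_continuant_le_matNorm _ z k)

/-- Along the ellipse the Lyapunov exponent is a profile. -/
lemma IsDisorder.exists_isProfile_lyap (hw : IsDisorder P w₁ w₂) {a b : ℝ} (ha : 0 < a)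
    (hb : 0 < b) : ∃ (C : ℝ → ℝ → ℝ) (c : ℝ → ℝ) (d : ℝ) (f₁ f₂ : ℝ → ℝ),
      (∀ θ ∈ Ioo 0 (Real.pi / 2), 0 < c θ) ∧ 0 < d ∧
      IsProfile C c d (fun θ => lyap P w₁ w₂ (ellipse a b θ)) f₁ f₂ := by
  obtain ⟨m, M, hm, hbox⟩ := hw.exists_isBoxed
  obtain ⟨C, c, d, hc, hd, h⟩ := exists_isProfile_continuant ha hb hm M
  have hmeas : ∀ (n : ℕ) (θ : ℝ), AEMeasurable (fun ω => 1 / (n : ℝ) *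
      Real.log ‖(continuant (weights w₁ w₂ ω) n).eval (ellipse a b θ)‖) P := fun n θ =>
    ((Real.measurable_log.comp ((measurable_continuant_eval _ n).comp
      hw.measurable_weights).norm).const_mul _).aemeasurable
  have hprof := fun (n : ℕ) (hn : 0 < n) => IsProfile.integral (fun θ _ => hmeas n θ)
    (hbox.mono fun ω hω => h _ hω n hn)
  have hint : ∀ θ ∈ Ioo 0 Real.pi, ∀ᶠ n : ℕ in atTop, Integrable (fun ω => 1 / (n : ℝ) *
      Real.log ‖(continuant (weights w₁ w₂ ω) n).eval (ellipse a b θ)‖) P := fun θ hθ => by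
    obtain ⟨α, β, hα, hβ, hm, -⟩ := exists_Ioo_mem hθ hθ
    filter_upwards [eventually_gt_atTop 0] with n hn
    exact .of_bound (hmeas n θ).aestronglyMeasurable (C α β)
      (hbox.mono fun ω hω => ((h _ hω n hn).jet α β hα hβ).abs_zero θ hm)
  have hlim : ∀ θ ∈ Ioo 0 Real.pi, Tendsto (fun n : ℕ => ∫ ω, 1 / (n : ℝ) *
      Real.log ‖(continuant (weights w₁ w₂ ω) n).eval (ellipse a b θ)‖ ∂P) atTop
      (𝓝 (lyap P w₁ w₂ (ellipse a b θ))) := fun θ hθ =>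
    hw.tendsto_integral_log_continuant (by
      have := Real.sin_pos_of_mem_Ioo hθ
      rw [ellipse_re]; positivity) (hint θ hθ)
  obtain ⟨f₁, f₂, hf⟩ := IsProfile.exists_of_tendsto ((eventually_gt_atTop 0).mono hprof) hlim
  exact ⟨C, c, d, f₁, f₂, hc, hd, hf⟩

lemma IsDisorder.lyap_ellipse_zero_le (hw : IsDisorder P w₁ w₂) {a b : ℝ} (ha : 0 < a)
    (hb : 0 < b) (θ : ℝ) : lyap P w₁ w₂ (ellipse a b 0) ≤ lyap P w₁ w₂ (ellipse a b θ) := by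
  obtain ⟨m, M, hm, hbox⟩ := hw.exists_isBoxed
  refine le_of_tendsto_of_tendsto (hw.tendsto_meanLogGrowth _) (hw.tendsto_meanLogGrowth _) ?_
  filter_upwards [eventually_ge_atTop 2] with n h2
  obtain ⟨k, rfl⟩ := Nat.exists_eq_add_of_le' h2
  rw [meanLogGrowth_eq, meanLogGrowth_eq]
  refine mul_le_mul_of_nonneg_left ?_ (by positivity)
  refine integral_mono_ae (hw.integrable_log_matNorm _ _) (hw.integrable_log_matNorm _ _) ?_
  filter_upwards [hbox] with ω hω
  exact Real.log_le_log (matNorm_transferProd_pos m M hm _ hω _ _)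
    (matNorm_ellipse_zero_le ha hb hm hω k θ)

end Disorder

end LayeredDimer

theorem lemma3p3 {Ω : Type*} [MeasurableSpace Ω] (P : MeasureTheory.Measure Ω)
    [MeasureTheory.IsProbabilityMeasure P] (w₁ w₂ : ℕ → Ω → ℝ)
    (hw : LayeredDimer.IsDisorder P w₁ w₂) (a b : ℝ) (ha : 0 < a) (hb : 0 < b) :
    -- the limit that defines `L(z)` exists for every `z`
    (∀ z : ℂ, Filter.Tendsto
      (LayeredDimer.meanLogGrowth P
        (fun y ω => LayeredDimer.transferMatrix z (w₁ y ω) (w₂ y ω)))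
      Filter.atTop (nhds (LayeredDimer.lyap P w₁ w₂ z))) ∧
    StrictMonoOn (fun θ : ℝ => LayeredDimer.lyap P w₁ w₂ (LayeredDimer.ellipse a b θ))
      (Set.Icc 0 (Real.pi / 2)) ∧
    (∀ θ ∈ Set.Ioo (0 : ℝ) (Real.pi / 2),
      DifferentiableAt ℝ
        (fun θ : ℝ => LayeredDimer.lyap P w₁ w₂ (LayeredDimer.ellipse a b θ)) θ ∧
      0 < deriv (fun θ : ℝ => LayeredDimer.lyap P w₁ w₂ (LayeredDimer.ellipse a b θ)) θ) ∧
    -- twice continuously differentiable at `π / 2`, so both derivatives there are genuine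
    ContDiffAt ℝ 2 (fun θ : ℝ => LayeredDimer.lyap P w₁ w₂ (LayeredDimer.ellipse a b θ))
      (Real.pi / 2) ∧
    deriv (fun θ : ℝ => LayeredDimer.lyap P w₁ w₂ (LayeredDimer.ellipse a b θ))
      (Real.pi / 2) = 0 ∧
    iteratedDeriv 2 (fun θ : ℝ => LayeredDimer.lyap P w₁ w₂ (LayeredDimer.ellipse a b θ))
      (Real.pi / 2) < 0 := by
  obtain ⟨C, c, d, f₁, f₂, hc, hd, hf⟩ := hw.exists_isProfile_lyap ha hb
  set f : ℝ → ℝ := fun θ => LayeredDimer.lyap P w₁ w₂ (LayeredDimer.ellipse a b θ)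
  have hpi := Real.pi_pos
  have hmid : Real.pi / 2 ∈ Ioo 0 Real.pi := ⟨by linarith, by linarith⟩
  have hsub : ∀ {θ}, θ ∈ Ioo 0 (Real.pi / 2) → θ ∈ Ioo 0 Real.pi := fun h =>
    ⟨h.1, by linarith [h.2]⟩
  have hpos : ∀ θ ∈ Ioo 0 (Real.pi / 2), 0 < deriv f θ := fun θ hθ => by
    rw [(hf.hasDerivAt (hsub hθ)).deriv]
    exact (hc θ hθ).trans_le (hf.pos θ hθ)
  have hderiv : ∀ θ ∈ Ioo 0 Real.pi, deriv f θ = f₁ θ := fun θ hθ => (hf.hasDerivAt hθ).deriv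
  have hderiv₁ : ∀ θ ∈ Ioo 0 Real.pi, HasDerivAt (deriv f) (f₂ θ) θ := fun θ hθ =>
    (hf.hasDerivAt_one hθ).congr_of_eventuallyEq
      (eventually_of_mem (Ioo_mem_nhds hθ.1 hθ.2) hderiv)
  have hmono : StrictMonoOn f (Ioc 0 (Real.pi / 2)) := by
    refine strictMonoOn_of_deriv_pos (convex_Ioc _ _) (fun θ hθ => ?_) fun θ hθ => ?_
    · exact (hf.hasDerivAt ⟨hθ.1, by linarith [hθ.2]⟩).continuousAt.continuousWithinAt
    · rw [interior_Ioc] at hθ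
      exact hpos θ hθ
  refine ⟨hw.tendsto_meanLogGrowth, ?_, fun θ hθ => ⟨(hf.hasDerivAt (hsub hθ)).differentiableAt,
    hpos θ hθ⟩, ?_, ?_, ?_⟩
  · intro x hx y hy hxy
    -- No continuity at `0` is needed: `L(z(0)) ≤ L(z(y / 2)) < L(z(y))`.
    rcases hx.1.eq_or_lt with rfl | h0
    · have hle : f 0 ≤ f (y / 2) := hw.lyap_ellipse_zero_le ha hb (y / 2)
      exact hle.trans_lt
        (hmono ⟨by linarith, by linarith [hy.2]⟩ ⟨hxy, hy.2⟩ (by linarith))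
    · exact hmono ⟨h0, hx.2⟩ ⟨h0.trans hxy, hy.2⟩ hxy
  · have hC1 : ContDiffOn ℝ 1 (deriv f) (Ioo 0 Real.pi) := by
      rw [← zero_add (1 : WithTop ℕ∞), contDiffOn_succ_iff_deriv_of_isOpen isOpen_Ioo]
      refine ⟨fun θ hθ => (hderiv₁ θ hθ).differentiableAt.differentiableWithinAt, by simp, ?_⟩
      rw [contDiffOn_zero]
      refine ContinuousOn.congr (f := f₂) (fun θ hθ => (hf.continuousAt_two hθ).continuousWithinAt)
        fun θ hθ => (hderiv₁ θ hθ).deriv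
    have hC2 : ContDiffOn ℝ 2 f (Ioo 0 Real.pi) := by
      rw [← one_add_one_eq_two, contDiffOn_succ_iff_deriv_of_isOpen isOpen_Ioo]
      exact ⟨fun θ hθ => (hf.hasDerivAt hθ).differentiableAt.differentiableWithinAt, by simp, hC1⟩
    exact hC2.contDiffAt (Ioo_mem_nhds hmid.1 hmid.2)
  · rw [hderiv _ hmid, hf.crit]
  · rw [iteratedDeriv_succ, iteratedDeriv_one, (hderiv₁ _ hmid).deriv]
    exact hf.neg.trans_lt (neg_neg_of_pos hd)
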